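/- **Market.** There are $J$ goods. An individual is described by functions $Y(w,p)\in\mathbb R$ (outcome), $D(w,p)\in\mathbb R^J$ (demand) and $S(w,p)\in\mathbb R^J$ (supply) of the own treatment $w\in\{0,1\}$ and of the price $p\in\mathbb R^J$; $Z=D-S$ is excess demand. These triples belong to a class $\mathcal G$ with a probability distribution $\Theta$. Fix $0<\pi<1$ and put $y(w,p)=\mathbb E[Y(w,p)]$, $y_\pi(p)=\pi y(1,p)+(1-\pi)y(0,p)$, $z_\pi(p)=\pi\,\mathbb E[Z(1,p)]+(1-\pi)\,\mathbb E[Z(0,p)]$. **Assumptions.** 1. There are $l,u\in(0,\infty)^J$ such that for each good $j$, each $w$ and each member of $\mathcal G$: $Z_j(w,p)\le 0$ for all $p$ with $p_j\ge u_j$, and $Z_j(w,p)\ge 0$ for all $p$ with $p_j\le l_j$; for each $j$ and $w$ each of the two inequalities is strict (for all such $p$) on a subset of $\mathcal G$ of positive $\Theta$-measure. Let $\mathcal S=\{p: l\le p\le u\}$. 2. All functions $Y(w,\cdot),D(w,\cdot),S(w,\cdot)$ are twice continuously differentiable and, with their first and second derivatives, bounded on a neighbourhood of $\mathcal S$, with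 neighbourhood and bound common to all members of $\mathcal G$. 3. With $p^*_\pi$ the zero of $z_\pi$ in $\mathcal S$: the Jacobian of $z_\pi$ at $p^*_\pi$ is invertible; the Jacobian of $p\mapsto z_\pi(p)+p$ has operator norm less than $1$ on $\mathcal S$; $\mathbb E[Z(W,p^*_\pi)Z(W,p^*_\pi)^\top]$ is invertible, where $W\sim\mathrm{Bernoulli}(\pi)$ is independent of $Z$. 4. For each $n$, the triples $(Y_i(\cdot),D_i(\cdot),S_i(\cdot))$, $i\le n$, are i.i.d. from $\Theta$, the treatments $W_i$ are i.i.d. $\mathrm{Bernoulli}(\pi)$, the perturbations $U_{ij}$, $j\le J$, are i.i.d. uniform on $\{-h_n,h_n\}$, and these are independent; $h_n=cn^{-\alpha}$ with $c>0$ and $\frac14<\alpha<\frac12$. 5. There are $B>0$ and $a_n$ with $n a_n\to0$ such that almost surely, for all large $n$ and all $V\in[-B,B]^{n\times J}$, there is $p$ with $\bigl\|\frac1n\sum_{i\le n} Z_i(W_i,p+V_i)\bigr\|\le a_n$. **Data.** Let $\tilde P$ be a minimizer (ties broken in any way) of $p\mapsto\bigl\|\frac1n\sum_{i\le n} Z_i(W_i,p+U_i)\bigr\|$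 over $\mathbb R^J$, let $Y_i=Y_i(W_i,\tilde P+U_i)$ and $Z_i=Z_i(W_i,\tilde P+U_i)$, and let $\mathbf Y$, $\mathbf Z$, $\mathbf U$ have rows $Y_i$, $Z_i^\top$, $U_i^\top$. Define $$\hat\Delta_y=(\mathbf U^\top\mathbf U)^{-1}\mathbf U^\top\mathbf Y,\qquad \hat\Delta_z=(\mathbf U^\top\mathbf U)^{-1}\mathbf U^\top\mathbf Z,\qquad \hat\tau^{HT}_z=\frac1n\sum_{i=1}^n\Bigl(\frac{W_iZ_i}{\pi}-\frac{(1-W_i)Z_i}{1-\pi}\Bigr),$$ $$\hat\gamma=\hat\Delta_z^{-1}\hat\Delta_y,\qquad \hat b=(\hat\Delta_z^{\top})^{-1}\hat\tau^{HT}_z,\qquad \hat v^2=\frac1n\sum_{i=1}^n(Y_i-Z_i^\top\hat\gamma)^2,\qquad \hat\sigma_I^2=\hat b^\top\hat b\;\hat v^2 .$$ **Claim.** The function $z_\pi$ has exactly one zero $p^*_\pi$ in $\mathcal S$, the mean-field price $\pi'\mapsto p^*_{\pi'}$ is differentiable at $\pi$, and, as $n\to\infty$, $\hat\sigma_I^2$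 converges in probability to $$\sigma_I^2=\mathbb E\bigl[(Y(W,p^*_\pi)-Z(W,p^*_\pi)^\top\gamma)^2\bigr]\,\Bigl[\frac{d}{d\pi}p^*_\pi\Bigr]^\top\frac{d}{d\pi}p^*_\pi,\qquad \gamma=G^{-1}\nabla_p y_\pi(p^*_\pi),\quad G_{jk}=\frac{\partial (z_\pi)_k}{\partial p_j}(p^*_\pi).$$ -/

import Mathlib

open MeasureTheory ProbabilityTheory Filter Topology
open scoped Matrix

/-- Price vectors (and commodity bundles) for `J` goods, with the Euclidean norm. -/
abbrev Price (J : ℕ) := EuclideanSpace ℝ (Fin J)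

/-- The class of triples of outcome, demand and supply functions from which individuals are drawn,
indexed by a type `ξ : Ξ`. Each function takes the individual's own treatment (`true` = treated)
and the price vector that the individual faces. -/
structure Market (Ξ : Type*) (J : ℕ) where
  outcome : Ξ → Bool → Price J → ℝ
  demand : Ξ → Bool → Price J → Price J
  supply : Ξ → Bool → Price J → Price J

/-- The box `{p : l ≤ p ≤ u}` of prices. -/
def priceBox {J : ℕ} (l u : Price J) : Set (Price J) :=
  {p | ∀ j, l j ≤ p j ∧ p j ≤ u j}

/-- Law of a binary treatment that is assigned with probability `π`. -/
noncomputable def treatmentLaw (π : ℝ) : Measure Bool :=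
  ENNReal.ofReal π • Measure.dirac true + ENNReal.ofReal (1 - π) • Measure.dirac false

/-- Law of a vector of `J` independent variables, each uniform on `{-h, h}`. -/
noncomputable def perturbationLaw (J : ℕ) (h : ℝ) : Measure (Fin J → ℝ) :=
  Measure.pi fun _ => (2⁻¹ : ENNReal) • Measure.dirac (-h) + (2⁻¹ : ENNReal) • Measure.dirac h

namespace Market

variable {Ξ : Type*} {J : ℕ}

/-- Individual excess demand. -/
def excess (M : Market Ξ J) (ξ : Ξ) (w : Bool) (p : Price J) : Price J :=
  M.demand ξ w p - M.supply ξ w p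

/-! ### Assumptions on the class of functions -/

/-- The functions, evaluated at a fixed treatment and price, are random variables. -/
structure IsMeasurable [MeasurableSpace Ξ] (M : Market Ξ J) : Prop where
  outcome : ∀ w p, Measurable fun ξ => M.outcome ξ w p
  demand : ∀ w p, Measurable fun ξ => M.demand ξ w p
  supply : ∀ w p, Measurable fun ξ => M.supply ξ w p

/-- Good by good, no individual has positive excess demand for a good whose price is at least its
upper bound, or negative excess demand for a good whose price is at most its lower bound, and for
types of positive probability the inequalities are strict. -/
structure HasPriceBounds [MeasurableSpace Ξ] (M : Market Ξ J) (Θ : Measure Ξ) (l u : Price J) :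
    Prop where
  lower_pos : ∀ j, 0 < l j
  upper_pos : ∀ j, 0 < u j
  upper : ∀ ξ w j p, u j ≤ p j → M.excess ξ w p j ≤ 0
  upper_strict : ∀ w j, ∃ A : Set Ξ, MeasurableSet A ∧ 0 < Θ A ∧
    ∀ ξ ∈ A, ∀ p : Price J, u j ≤ p j → M.excess ξ w p j < 0
  lower : ∀ ξ w j p, p j ≤ l j → 0 ≤ M.excess ξ w p j
  lower_strict : ∀ w j, ∃ A : Set Ξ, MeasurableSet A ∧ 0 < Θ A ∧
    ∀ ξ ∈ A, ∀ p : Price J, p j ≤ l j → 0 < M.excess ξ w p j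

/-- All functions are twice continuously differentiable in the price; they and their first two
derivatives are bounded, uniformly over the class, on a neighbourhood of the box of prices. -/
structure IsSmoothBounded (M : Market Ξ J) (l u : Price J) : Prop where
  outcome : ∀ ξ w, ContDiff ℝ 2 (M.outcome ξ w)
  demand : ∀ ξ w, ContDiff ℝ 2 (M.demand ξ w)
  supply : ∀ ξ w, ContDiff ℝ 2 (M.supply ξ w)
  bounded : ∃ δ > 0, ∃ C : ℝ, ∀ ξ w, ∀ p ∈ Metric.thickening δ (priceBox l u), ∀ r ≤ 2,
    ‖iteratedFDeriv ℝ r (M.outcome ξ w) p‖ ≤ C ∧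
    ‖iteratedFDeriv ℝ r (M.demand ξ w) p‖ ≤ C ∧
    ‖iteratedFDeriv ℝ r (M.supply ξ w) p‖ ≤ C

/-! ### Mean-field quantities -/

section MeanField

variable [MeasurableSpace Ξ]

/-- `y(w, p)`. -/
noncomputable def meanOutcome (M : Market Ξ J) (Θ : Measure Ξ) (w : Bool) (p : Price J) : ℝ :=
  ∫ ξ, M.outcome ξ w p ∂Θ

/-- `d(w, p)`. -/
noncomputable def meanDemand (M : Market Ξ J) (Θ : Measure Ξ) (w : Bool) (p : Price J) :
    Price J :=
  ∫ ξ, M.demand ξ w p ∂Θ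

/-- `s(w, p)`. -/
noncomputable def meanSupply (M : Market Ξ J) (Θ : Measure Ξ) (w : Bool) (p : Price J) :
    Price J :=
  ∫ ξ, M.supply ξ w p ∂Θ

/-- `y_π(p) = π y(1, p) + (1 - π) y(0, p)`. -/
noncomputable def mixedOutcome (M : Market Ξ J) (Θ : Measure Ξ) (π : ℝ) (p : Price J) : ℝ :=
  π * M.meanOutcome Θ true p + (1 - π) * M.meanOutcome Θ false p

/-- `z_π(p) = π [d(1, p) - s(1, p)] + (1 - π) [d(0, p) - s(0, p)]`. -/
noncomputable def mixedExcess (M : Market Ξ J) (Θ : Measure Ξ) (π : ℝ) (p : Price J) : Price J :=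
  π • (M.meanDemand Θ true p - M.meanSupply Θ true p) +
    (1 - π) • (M.meanDemand Θ false p - M.meanSupply Θ false p)

/-- `p` is a market-clearing price of the mean-field market. -/
def IsMeanFieldPrice (M : Market Ξ J) (Θ : Measure Ξ) (l u : Price J) (π : ℝ) (p : Price J) :
    Prop :=
  p ∈ priceBox l u ∧ M.mixedExcess Θ π p = 0

/-- The mean-field price `p*_π`, as a function of `π` (an arbitrary value where there is none). -/
noncomputable def meanFieldPrice (M : Market Ξ J) (Θ : Measure Ξ) (l u : Price J) (π : ℝ) :
    Price J :=
  Classical.epsilon (M.IsMeanFieldPrice Θ l u π)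

/-- Gradient of `y_π` with respect to prices. -/
noncomputable def outcomeGradient (M : Market Ξ J) (Θ : Measure Ξ) (π : ℝ) (p : Price J) :
    Fin J → ℝ :=
  fun j => fderiv ℝ (M.mixedOutcome Θ π) p (EuclideanSpace.single j 1)

/-- Derivatives of `z_π` with respect to prices: the entry `(j, k)` is the derivative of the excess
demand for good `k` with respect to the price of good `j`. -/
noncomputable def excessGradient (M : Market Ξ J) (Θ : Measure Ξ) (π : ℝ) (p : Price J) :
    Matrix (Fin J) (Fin J) ℝ :=
  Matrix.of fun j k => fderiv ℝ (M.mixedExcess Θ π) p (EuclideanSpace.single j 1) k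

/-- `γ = (∇_p z_π)⁻¹ ∇_p y_π` at the mean-field price. -/
noncomputable def gamma (M : Market Ξ J) (Θ : Measure Ξ) (l u : Price J) (π : ℝ) : Fin J → ℝ :=
  (M.excessGradient Θ π (M.meanFieldPrice Θ l u π))⁻¹ *ᵥ
    M.outcomeGradient Θ π (M.meanFieldPrice Θ l u π)

/-- `E[Z_i(W_i, p) Z_i(W_i, p)ᵀ]`. -/
noncomputable def excessSecondMoment (M : Market Ξ J) (Θ : Measure Ξ) (π : ℝ) (p : Price J) :
    Matrix (Fin J) (Fin J) ℝ :=
  Matrix.of fun j k =>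
    ∫ x, M.excess x.1 x.2 p j * M.excess x.1 x.2 p k ∂(Θ.prod (treatmentLaw π))

/-- `E[(Y_i(W_i, p*) - Z_i(W_i, p*)ᵀ γ)²]`. -/
noncomputable def residualVariance (M : Market Ξ J) (Θ : Measure Ξ) (l u : Price J) (π : ℝ) : ℝ :=
  ∫ x, (M.outcome x.1 x.2 (M.meanFieldPrice Θ l u π) -
    (fun j => M.excess x.1 x.2 (M.meanFieldPrice Θ l u π) j) ⬝ᵥ M.gamma Θ l u π) ^ 2
    ∂(Θ.prod (treatmentLaw π))

/-- The asymptotic variance `σ_I²` of the estimator of the average indirect effect. -/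
noncomputable def sigmaISq (M : Market Ξ J) (Θ : Measure Ξ) (l u : Price J) (π : ℝ) : ℝ :=
  M.residualVariance Θ l u π *
    inner ℝ (deriv (M.meanFieldPrice Θ l u) π) (deriv (M.meanFieldPrice Θ l u) π)

/-- Regularity of the mean-field market at `π`: the Jacobian of `z_π` has full rank at the
mean-field price, `p ↦ z_π(p) + p` has a Jacobian of operator norm less than one on the box, and
the second moment matrix of excess demand at the mean-field price has full rank. -/
structure IsRegular (M : Market Ξ J) (Θ : Measure Ξ) (l u : Price J) (π : ℝ) : Prop where
  jacobian : IsUnit (M.excessGradient Θ π (M.meanFieldPrice Θ l u π))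
  contraction : ∀ p ∈ priceBox l u, ‖fderiv ℝ (fun q => M.mixedExcess Θ π q + q) p‖ < 1
  secondMoment : IsUnit (M.excessSecondMoment Θ π (M.meanFieldPrice Θ l u π))

end MeanField

/-! ### The finite market -/

/-- Average excess demand of `n` individuals with types `ξ` and treatments `W`, when individual `i`
faces the price `p + U i`. -/
noncomputable def averageExcess (M : Market Ξ J) {n : ℕ} (ξ : Fin n → Ξ) (W : Fin n → Bool)
    (U : Fin n → Fin J → ℝ) (p : Price J) : Price J :=
  (n : ℝ)⁻¹ • ∑ i, M.excess (ξ i) (W i) (p + WithLp.toLp 2 (U i))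

/-- `p` comes closest to clearing the perturbed market. -/
def IsMarketPrice (M : Market Ξ J) {n : ℕ} (ξ : Fin n → Ξ) (W : Fin n → Bool)
    (U : Fin n → Fin J → ℝ) (p : Price J) : Prop :=
  ∀ q, ‖M.averageExcess ξ W U p‖ ≤ ‖M.averageExcess ξ W U q‖

/-- Observed outcomes `Y_i` at the market price `p`. -/
def observedOutcome (M : Market Ξ J) {n : ℕ} (ξ : Fin n → Ξ) (W : Fin n → Bool)
    (U : Fin n → Fin J → ℝ) (p : Price J) : Fin n → ℝ :=
  fun i => M.outcome (ξ i) (W i) (p + WithLp.toLp 2 (U i))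

/-- The `n × J` matrix of observed excess demands `Z_i` at the market price `p`. -/
def observedExcess (M : Market Ξ J) {n : ℕ} (ξ : Fin n → Ξ) (W : Fin n → Bool)
    (U : Fin n → Fin J → ℝ) (p : Price J) : Matrix (Fin n) (Fin J) ℝ :=
  Matrix.of fun i j => M.excess (ξ i) (W i) (p + WithLp.toLp 2 (U i)) j

end Market

/-! ### Estimators, as functions of the observed data -/

namespace Estimator

variable {n J : ℕ}

/-- Regression of outcomes on price perturbations, `(UᵀU)⁻¹ (UᵀY)`. -/
noncomputable def deltaY (U : Matrix (Fin n) (Fin J) ℝ) (Y : Fin n → ℝ) : Fin J → ℝ :=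
  (Uᵀ * U)⁻¹ *ᵥ (Uᵀ *ᵥ Y)

/-- Regressions of excess demands on price perturbations, `(UᵀU)⁻¹ (UᵀZ)`; the entry `(j, k)`
is the marginal response of the excess demand for good `k` to the price of good `j`. -/
noncomputable def deltaZ (U Z : Matrix (Fin n) (Fin J) ℝ) : Matrix (Fin J) (Fin J) ℝ :=
  (Uᵀ * U)⁻¹ * (Uᵀ * Z)

/-- Horvitz-Thompson estimator of the direct effect of the treatment on excess demand. -/
noncomputable def tauZ (π : ℝ) (W : Fin n → Bool) (Z : Matrix (Fin n) (Fin J) ℝ) : Fin J → ℝ :=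
  fun j => (n : ℝ)⁻¹ *
    ∑ i, ((if W i then 1 else 0) * Z i j / π - (1 - if W i then 1 else 0) * Z i j / (1 - π))

/-- Weak instrumental variables estimator `γ̂ = Δ̂_z⁻¹ Δ̂_y`. -/
noncomputable def gammaHat (U Z : Matrix (Fin n) (Fin J) ℝ) (Y : Fin n → ℝ) : Fin J → ℝ :=
  (deltaZ U Z)⁻¹ *ᵥ deltaY U Y

/-- Estimator of the derivative of the mean-field price in `π`, up to sign. The system that is
solved is that of the estimated Jacobian of excess demand, whose rows are indexed by goods and
whose columns are indexed by prices; this is the transpose of `deltaZ`. -/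
noncomputable def bHat (π : ℝ) (W : Fin n → Bool) (U Z : Matrix (Fin n) (Fin J) ℝ) : Fin J → ℝ :=
  ((deltaZ U Z)ᵀ)⁻¹ *ᵥ tauZ π W Z

/-- Empirical residual variance. -/
noncomputable def vHatSq (U Z : Matrix (Fin n) (Fin J) ℝ) (Y : Fin n → ℝ) : ℝ :=
  (n : ℝ)⁻¹ * ∑ i, (Y i - Z i ⬝ᵥ gammaHat U Z Y) ^ 2

/-- The plug-in estimator `b̂ᵀ b̂ · v̂²`. -/
noncomputable def sigmaISqHat (π : ℝ) (W : Fin n → Bool) (U Z : Matrix (Fin n) (Fin J) ℝ)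
    (Y : Fin n → ℝ) : ℝ :=
  (bHat π W U Z ⬝ᵥ bHat π W U Z) * vHatSq U Z Y

end Estimator

/-! Mean-field market. On the compact box the Jacobian of `z_π + id` has norm at most some `κ < 1`,
so `z_π + id` is a contraction there. Because `z_π` points inwards on the faces, the damped map `p +
z_π(p)/2` preserves the box, and Banach's theorem gives the unique zero `p*`
(`existsUnique_zero_of_contraction`). The contraction survives small changes of `π`, which makes the
price Lipschitz in `π`. Implicit differentiation then gives `dp*/dπ = -(Gᵀ)⁻¹ τ`, where `τ` is the
mean effect of treatment on excess demand (`hasDerivAt_meanFieldPrice`).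

Market price. By the law of large numbers for gradients at `p*`, average excess demand plus the
identity is, with probability tending to one, a contraction of a fixed ball around `p*`. At `p*`
average excess demand is `O(h_n)`, since `n h_n² → ∞` makes the sampling error `o(h_n)` and the
perturbations shift it by `O(h_n)`. Banach's theorem then yields an exact zero, so the minimizer is
an exact zero too. The price bounds and a uniform law of large numbers on the box force that zero
into the ball, and the contraction sharpens its distance to `p*` to `O(h_n)`
(`eventually_norm_marketPrice_sub_le`).

Regressions. The price depends on all the perturbations, so responses are expanded at the
deterministic point `p*`. After division by `h_n²`, the terms linear in `U` are centred with
variance of order `1/(n h_n²)`, the terms quadratic in `U` produce the mean derivative, and the rate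
for the price makes the remainder `O(h_n)` (`tendsto_avg_perturbation_mul`). Hence `Δ̂_z → G`, `Δ̂_y
→ ∇y_π`, `τ̂ → τ`, and by continuity `γ̂ → γ` and `b̂ → -dp*/dπ`. The residual variance converges as
well, and the sign is lost in `b̂ᵀb̂`.

All limits are taken along the single filter `inProbability μ`. Being defined by outer probability,
it requires no measurability of the price, and it turns convergence in probability into ordinary
`Tendsto` calculus. -/

/-! ### Convergence in probability as convergence along a filter -/

section InProbability

variable {Ω : Type*} [MeasurableSpace Ω]

/-- The filter on `ℕ × Ω` of the sets whose `n`-th section has outer probability tending to one. -/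
def inProbability (μ : Measure Ω) : Filter (ℕ × Ω) where
  sets := {S | Tendsto (fun n => μ {ω | (n, ω) ∉ S}) atTop (𝓝 0)}
  univ_sets := by simp
  sets_of_superset := by
    intro S T hS hST
    refine tendsto_of_tendsto_of_tendsto_of_le_of_le tendsto_const_nhds hS (fun _ => zero_le) ?_
    exact fun n => measure_mono fun ω hω h => hω (hST h)
  inter_sets := by
    intro S T hS hT
    have h : Tendsto (fun n => μ {ω | (n, ω) ∉ S} + μ {ω | (n, ω) ∉ T}) atTop (𝓝 0) := by
      simpa using Tendsto.add hS hT
    refine tendsto_of_tendsto_of_tendsto_of_le_of_le tendsto_const_nhds h (fun _ => zero_le) ?_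
    refine fun n => (measure_mono ?_).trans (measure_union_le _ _)
    intro ω hω
    by_contra hc
    simp only [Set.mem_union, Set.mem_ofPred_eq, not_or, not_not] at hc
    exact hω ⟨hc.1, hc.2⟩

variable {μ : Measure Ω}

theorem eventually_inProbability {p : ℕ × Ω → Prop} :
    (∀ᶠ y in inProbability μ, p y) ↔ Tendsto (fun n => μ {ω | ¬ p (n, ω)}) atTop (𝓝 0) :=
  Iff.rfl

theorem eventually_inProbability_of_ae {p : ℕ × Ω → Prop}
    (h : ∀ᶠ n in atTop, ∀ᵐ ω ∂μ, p (n, ω)) : ∀ᶠ y in inProbability μ, p y := by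
  rw [eventually_inProbability]
  refine tendsto_const_nhds.congr' ?_
  filter_upwards [h] with n hn
  exact (ae_iff.1 hn).symm

theorem tendsto_fst_inProbability : Tendsto Prod.fst (inProbability μ) atTop := by
  intro S hS
  refine eventually_inProbability_of_ae (p := fun y => y.1 ∈ S) ?_
  filter_upwards [hS] with n hn
  exact Eventually.of_forall fun _ => hn

/-- The dictionary between probability and filters: continuous mapping, sums, products and squeezing
are then inherited from `Tendsto`. -/
theorem tendstoInMeasure_iff_inProbability {E : Type*} [PseudoEMetricSpace E] {f : ℕ → Ω → E}
    {c : E} :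
    TendstoInMeasure μ f atTop (fun _ => c) ↔
      Tendsto (fun y : ℕ × Ω => f y.1 y.2) (inProbability μ) (𝓝 c) := by
  rw [EMetric.tendsto_nhds]
  simp only [TendstoInMeasure, eventually_inProbability, not_lt]

end InProbability

/-! ### Averages -/

/-- The average of finitely many numbers. -/
noncomputable def avg {n : ℕ} (a : Fin n → ℝ) : ℝ := (n : ℝ)⁻¹ * ∑ i, a i

section Avg

variable {n : ℕ}

theorem avg_add (a b : Fin n → ℝ) : avg (fun i => a i + b i) = avg a + avg b := by
  simp [avg, Finset.sum_add_distrib, mul_add]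

theorem avg_sub (a b : Fin n → ℝ) : avg (fun i => a i - b i) = avg a - avg b := by
  simp [avg, Finset.sum_sub_distrib, mul_sub]

theorem avg_const_mul (c : ℝ) (a : Fin n → ℝ) : avg (fun i => c * a i) = c * avg a := by
  simp only [avg, ← Finset.mul_sum]; ring

theorem avg_sum {κ : Type*} (s : Finset κ) (a : κ → Fin n → ℝ) :
    avg (fun i => ∑ k ∈ s, a k i) = ∑ k ∈ s, avg (a k) := by
  simp only [avg, Finset.mul_sum]
  exact Finset.sum_comm

theorem abs_avg_le {a : Fin n → ℝ} {K : ℝ} (hK : 0 ≤ K) (h : ∀ i, |a i| ≤ K) : |avg a| ≤ K := by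
  rw [avg, abs_mul, abs_inv, Nat.abs_cast]
  have h1 : |∑ i, a i| ≤ n * K := by
    refine (Finset.abs_sum_le_sum_abs _ _).trans ((Finset.sum_le_sum fun i _ => h i).trans ?_)
    simp
  rcases Nat.eq_zero_or_pos n with rfl | hn
  · simpa using hK
  · have : (0 : ℝ) < n := by exact_mod_cast hn
    rw [inv_mul_le_iff₀ this]
    exact h1

theorem abs_avg_sub_avg_le {a b : Fin n → ℝ} {K : ℝ} (hK : 0 ≤ K) (h : ∀ i, |a i - b i| ≤ K) :
    |avg a - avg b| ≤ K := by
  rw [← avg_sub]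
  exact abs_avg_le hK h

end Avg

/-! ### Weak law of large numbers for triangular arrays -/

section LLN

variable {Ω X : Type*} [MeasurableSpace Ω] [MeasurableSpace X] {μ : Measure Ω}
  [IsProbabilityMeasure μ]

/-- Chebyshev's inequality for the average of independent copies of a bounded variable. -/
theorem measure_abs_avg_sub_integral_ge_le {n : ℕ} {T : Fin n → Ω → X} {ν : Measure X}
    [IsProbabilityMeasure ν] (hind : iIndepFun T μ) (hlaw : ∀ i, HasLaw (T i) ν μ) {g : X → ℝ}
    (hg : Measurable g) {K : ℝ} (hK : ∀ᵐ x ∂ν, |g x| ≤ K) {ε : ℝ} (hε : 0 < ε) (hn : n ≠ 0) :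
    μ {ω | ε ≤ |avg (fun i => g (T i ω)) - ∫ x, g x ∂ν|} ≤ ENNReal.ofReal (K ^ 2 / n / ε ^ 2) := by
  have hn' : (0 : ℝ) < n := by exact_mod_cast Nat.pos_of_ne_zero hn
  have hL : ∀ i, HasLaw (fun ω => g (T i ω)) (ν.map g) μ := fun i =>
    HasLaw.fun_comp (X := T i) (Y := g) ⟨hg.aemeasurable, rfl⟩ (hlaw i)
  have hb : ∀ i, ∀ᵐ ω ∂μ, |g (T i ω)| ≤ K := by
    intro i
    have h1 := (hlaw i).map_eq ▸ hK
    exact ae_of_ae_map (hlaw i).aemeasurable h1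
  have hmem : ∀ i, MemLp (fun ω => g (T i ω)) 2 μ := fun i =>
    MemLp.of_bound (hL i).aemeasurable.aestronglyMeasurable K (hb i)
  have hvar : ∀ i, variance (fun ω => g (T i ω)) μ ≤ K ^ 2 := by
    intro i
    have := variance_le_sq_of_bounded (μ := μ) (a := -K) (b := K)
      ((hb i).mono fun ω hω => abs_le.1 hω) (hL i).aemeasurable
    linarith [this, show ((K - -K) / 2) ^ 2 = K ^ 2 by ring]
  have hE : ∀ i, ∫ ω, g (T i ω) ∂μ = ∫ x, g x ∂ν := fun i =>
    (hlaw i).integral_comp hg.aestronglyMeasurable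
  have hindg : iIndepFun (fun i ω => g (T i ω)) μ := hind.comp (fun _ => g) (fun _ => hg)
  have hint : ∀ i, Integrable (fun ω => g (T i ω)) μ := fun i => (hmem i).integrable (by norm_num)
  have hmean : ∫ ω, avg (fun i => g (T i ω)) ∂μ = ∫ x, g x ∂ν := by
    simp only [avg]
    rw [integral_const_mul, integral_finsetSum _ fun i _ => hint i]
    simp only [hE, Finset.sum_const, Finset.card_univ, Fintype.card_fin, nsmul_eq_mul]
    field_simp
  have hsum : MemLp (fun ω => ∑ i, g (T i ω)) 2 μ := memLp_finsetSum _ fun i _ => hmem i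
  have havg : MemLp (fun ω => avg (fun i => g (T i ω))) 2 μ := hsum.const_mul _
  have hv : variance (fun ω => avg (fun i => g (T i ω))) μ ≤ K ^ 2 / n := by
    have h1 : variance (fun ω => ∑ i, g (T i ω)) μ = ∑ i, variance (fun ω => g (T i ω)) μ := by
      have := IndepFun.variance_sum (μ := μ) (s := Finset.univ) (X := fun i ω => g (T i ω))
        (fun i _ => hmem i) (fun i _ j _ hij => hindg.indepFun hij)
      rw [← this]
      congr 1
      ext ω
      simp
    simp only [avg]
    rw [variance_const_mul, h1]
    have h2 : ∑ i, variance (fun ω => g (T i ω)) μ ≤ n * K ^ 2 :=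
      (Finset.sum_le_sum fun i _ => hvar i).trans (by simp)
    calc ((n : ℝ)⁻¹) ^ 2 * ∑ i, variance (fun ω => g (T i ω)) μ
        ≤ ((n : ℝ)⁻¹) ^ 2 * (n * K ^ 2) := by gcongr
      _ = K ^ 2 / n := by field_simp
  have := meas_ge_le_variance_div_sq (μ := μ) havg hε
  rw [hmean] at this
  exact this.trans (ENNReal.ofReal_le_ofReal (by gcongr))

/-- The bound `K n` may grow, as long as it is `o(√n)`. This leaves room to put the weights `1 / h
n` and `1 / h n ^ 2` into `g n`. -/
theorem tendsto_avg_sub_integral {T : (n : ℕ) → Fin n → Ω → X} {ν : ℕ → Measure X}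
    [∀ n, IsProbabilityMeasure (ν n)] (hind : ∀ n, iIndepFun (T n) μ)
    (hlaw : ∀ n i, HasLaw (T n i) (ν n) μ) {g : ℕ → X → ℝ} (hg : ∀ n, Measurable (g n))
    {K : ℕ → ℝ} (hK : ∀ᶠ n in atTop, ∀ᵐ x ∂ν n, |g n x| ≤ K n)
    (hlim : Tendsto (fun n : ℕ => K n ^ 2 / n) atTop (𝓝 0)) :
    Tendsto (fun y : ℕ × Ω => avg (fun i => g y.1 (T y.1 i y.2)) - ∫ x, g y.1 x ∂ν y.1)
      (inProbability μ) (𝓝 0) := by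
  rw [Metric.tendsto_nhds]
  intro ε hε
  rw [eventually_inProbability]
  have h0 : Tendsto (fun n : ℕ => ENNReal.ofReal (K n ^ 2 / n / ε ^ 2)) atTop (𝓝 0) := by
    rw [← ENNReal.ofReal_zero]
    refine ENNReal.tendsto_ofReal ?_
    simpa using hlim.div_const (ε ^ 2)
  refine tendsto_of_tendsto_of_tendsto_of_le_of_le' tendsto_const_nhds h0
    (Eventually.of_forall fun _ => zero_le) ?_
  filter_upwards [hK, eventually_ne_atTop 0] with n hKn hn
  refine le_trans (le_of_eq ?_)
    (measure_abs_avg_sub_integral_ge_le (hind n) (hlaw n) (hg n) hKn hε hn)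
  simp

end LLN

/-! ### Treatments and perturbations -/

theorem isProbabilityMeasure_treatmentLaw {π : ℝ} (hπ : 0 < π ∧ π < 1) :
    IsProbabilityMeasure (treatmentLaw π) := by
  constructor
  simp only [treatmentLaw, Measure.coe_add, Measure.coe_smul, Pi.add_apply, Pi.smul_apply,
    measure_univ, smul_eq_mul, mul_one]
  rw [← ENNReal.ofReal_add hπ.1.le (by linarith [hπ.2])]
  simp

theorem integral_treatmentLaw {π : ℝ} (hπ : 0 < π ∧ π < 1) (f : Bool → ℝ) :
    ∫ w, f w ∂treatmentLaw π = π * f true + (1 - π) * f false := by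
  have : IsProbabilityMeasure (treatmentLaw π) := isProbabilityMeasure_treatmentLaw hπ
  rw [treatmentLaw, integral_add_measure (Integrable.of_finite.smul_measure (by simp))
    (Integrable.of_finite.smul_measure (by simp)), integral_smul_measure, integral_smul_measure]
  simp [ENNReal.toReal_ofReal hπ.1.le, ENNReal.toReal_ofReal (sub_nonneg.2 hπ.2.le)]

theorem integral_prod_treatmentLaw {Ξ : Type*} [MeasurableSpace Ξ] (Θ : Measure Ξ)
    [IsProbabilityMeasure Θ] {π : ℝ} (hπ : 0 < π ∧ π < 1) {f : Ξ × Bool → ℝ}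
    (hf : Integrable f (Θ.prod (treatmentLaw π)))
    (hf' : ∀ w, Integrable (fun ξ => f (ξ, w)) Θ) :
    ∫ x, f x ∂(Θ.prod (treatmentLaw π)) =
      π * ∫ ξ, f (ξ, true) ∂Θ + (1 - π) * ∫ ξ, f (ξ, false) ∂Θ := by
  have : IsProbabilityMeasure (treatmentLaw π) := isProbabilityMeasure_treatmentLaw hπ
  rw [integral_prod _ hf]
  simp only [integral_treatmentLaw hπ]
  rw [integral_add ((hf' _).const_mul _) ((hf' _).const_mul _), integral_const_mul,
    integral_const_mul]

/-- The uniform distribution on `{-h, h}`. -/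
noncomputable def signLaw (h : ℝ) : Measure ℝ :=
  (2⁻¹ : ENNReal) • Measure.dirac (-h) + (2⁻¹ : ENNReal) • Measure.dirac h

instance (h : ℝ) : IsProbabilityMeasure (signLaw h) := by
  constructor
  simp [signLaw, ENNReal.inv_two_add_inv_two]

theorem integral_signLaw (h : ℝ) (f : ℝ → ℝ) :
    ∫ x, f x ∂signLaw h = (f (-h) + f h) / 2 := by
  have hi : ∀ a : ℝ, Integrable f ((2⁻¹ : ENNReal) • Measure.dirac a) := fun a =>
    (integrable_dirac (by simp)).smul_measure (by simp)
  rw [signLaw, integral_add_measure (hi _) (hi _), integral_smul_measure, integral_smul_measure]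
  simp
  ring

theorem ae_signLaw (h : ℝ) : ∀ᵐ x ∂signLaw h, |x| = |h| := by
  have hm : MeasurableSet {x : ℝ | ¬ |x| = |h|} :=
    (measurableSet_eq_fun measurable_norm measurable_const).compl
  rw [ae_iff, signLaw]
  simp [hm]

theorem perturbationLaw_eq (J : ℕ) (h : ℝ) :
    perturbationLaw J h = Measure.pi fun _ => signLaw h := rfl

instance (J : ℕ) (h : ℝ) : IsProbabilityMeasure (perturbationLaw J h) := by
  rw [perturbationLaw_eq]; infer_instance

theorem ae_perturbationLaw (J : ℕ) (h : ℝ) :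
    ∀ᵐ v ∂perturbationLaw J h, ∀ j, |v j| = |h| := by
  rw [ae_all_iff]
  intro j
  have := (measurePreserving_eval (fun _ : Fin J => signLaw h) j).quasiMeasurePreserving.ae
    (ae_signLaw h)
  exact this

theorem integral_perturbationLaw_mul (J : ℕ) (h : ℝ) (j m : Fin J) :
    ∫ v, v j * v m ∂perturbationLaw J h = if j = m then h ^ 2 else 0 := by
  rw [perturbationLaw_eq]
  -- Written as a product over all coordinates, the integrand factorizes under the product measure.
  have h1 : ∀ v : Fin J → ℝ, v j * v m =
      ∏ i, ((if i = j then v i else 1) * (if i = m then v i else 1)) := by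
    intro v
    rw [Finset.prod_mul_distrib]
    simp
  simp only [h1]
  rw [integral_fintype_prod_eq_prod (fun i (x : ℝ) =>
    (if i = j then x else 1) * (if i = m then x else 1))]
  split_ifs with hjm
  · subst hjm
    have : ∀ i : Fin J, ∫ x, (if i = j then x else 1) * (if i = j then x else 1) ∂signLaw h =
        if i = j then h ^ 2 else 1 := by
      intro i
      rw [integral_signLaw]
      split_ifs <;> ring
    rw [Finset.prod_congr rfl fun i _ => this i]
    simp
  · refine Finset.prod_eq_zero (Finset.mem_univ j) ?_
    rw [integral_signLaw]
    simp [hjm]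

theorem integral_perturbationLaw (J : ℕ) (h : ℝ) (j : Fin J) :
    ∫ v, v j ∂perturbationLaw J h = 0 := by
  rw [perturbationLaw_eq]
  have h1 : ∀ v : Fin J → ℝ, v j = ∏ i, (if i = j then v i else 1) := by
    intro v
    simp
  simp only [h1]
  rw [integral_fintype_prod_eq_prod (fun i (x : ℝ) => if i = j then x else 1)]
  refine Finset.prod_eq_zero (Finset.mem_univ j) ?_
  rw [integral_signLaw]
  simp

/-! ### Samples with perturbed prices -/

/-- Samples of sizes `n = 1, 2, …` of characteristics `x` with law `ρ`, each with an independent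
vector of perturbations of size `h n`, which vanishes more slowly than `n ^ (-1/2)`. -/
structure IsPerturbedSample {Ω X : Type*} [MeasurableSpace Ω] [MeasurableSpace X] {J : ℕ}
    (μ : Measure Ω) (ρ : Measure X) (h : ℕ → ℝ) (x : (n : ℕ) → Fin n → Ω → X)
    (U : (n : ℕ) → Fin n → Ω → Fin J → ℝ) : Prop where
  indep : ∀ n, iIndepFun (fun i ω => (x n i ω, U n i ω)) μ
  law : ∀ n i, HasLaw (fun ω => (x n i ω, U n i ω)) (ρ.prod (perturbationLaw J (h n))) μ
  pos : ∀ᶠ n in atTop, 0 < h n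
  tendsto_zero : Tendsto h atTop (𝓝 0)
  slow : Tendsto (fun n : ℕ => ((n : ℝ) * h n ^ 2)⁻¹) atTop (𝓝 0)

namespace IsPerturbedSample

variable {Ω X : Type*} [MeasurableSpace Ω] [MeasurableSpace X] {J : ℕ} {μ : Measure Ω}
  {ρ : Measure X} {h : ℕ → ℝ} {x : (n : ℕ) → Fin n → Ω → X} {U : (n : ℕ) → Fin n → Ω → Fin J → ℝ}

theorem eventually_pos (hS : IsPerturbedSample μ ρ h x U) :
    ∀ᶠ y : ℕ × Ω in inProbability μ, 0 < h y.1 :=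
  tendsto_fst_inProbability.eventually hS.pos

theorem tendsto_size (hS : IsPerturbedSample μ ρ h x U) :
    Tendsto (fun y : ℕ × Ω => h y.1) (inProbability μ) (𝓝 0) :=
  hS.tendsto_zero.comp tendsto_fst_inProbability

theorem eventually_abs_eq (hS : IsPerturbedSample μ ρ h x U) :
    ∀ᶠ y : ℕ × Ω in inProbability μ, ∀ i j, |U y.1 i y.2 j| = h y.1 := by
  refine eventually_inProbability_of_ae ?_
  filter_upwards [hS.pos] with n hn
  rw [ae_all_iff]
  intro i
  have h1 : ∀ᵐ y ∂(ρ.prod (perturbationLaw J (h n))), ∀ j, |y.2 j| = |h n| :=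
    Measure.quasiMeasurePreserving_snd.ae (ae_perturbationLaw J (h n))
  rw [← (hS.law n i).map_eq] at h1
  filter_upwards [ae_of_ae_map (hS.law n i).aemeasurable h1] with ω hω j
  rw [hω j, abs_of_pos hn]

variable [IsProbabilityMeasure μ] [IsProbabilityMeasure ρ]

/-- A bound of order `1 / h n` is the borderline: Chebyshev's inequality then gives a variance of
order `1 / (n h²)`, which is what `slow` controls. -/
theorem tendsto_avg (hS : IsPerturbedSample μ ρ h x U) {g : ℕ → X × (Fin J → ℝ) → ℝ}
    (hg : ∀ n, Measurable (g n)) {C : ℝ}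
    (hC : ∀ᶠ n in atTop, ∀ᵐ z ∂ρ.prod (perturbationLaw J (h n)), |g n z| ≤ C / h n) :
    Tendsto (fun y : ℕ × Ω => avg (fun i => g y.1 (x y.1 i y.2, U y.1 i y.2)) -
      ∫ z, g y.1 z ∂ρ.prod (perturbationLaw J (h y.1))) (inProbability μ) (𝓝 0) := by
  refine tendsto_avg_sub_integral (ν := fun n => ρ.prod (perturbationLaw J (h n)))
    hS.indep hS.law hg hC ?_
  refine (Tendsto.congr (fun n => ?_) (by simpa using hS.slow.const_mul (C ^ 2)))
  simp only [div_eq_mul_inv, mul_pow, inv_pow]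
  ring

theorem integral_fst_mul (f : X → ℝ) (s : (Fin J → ℝ) → ℝ) (h : ℝ) :
    ∫ z, f z.1 * s z.2 ∂ρ.prod (perturbationLaw J h) =
      (∫ x, f x ∂ρ) * ∫ v, s v ∂perturbationLaw J h :=
  integral_prod_mul f s

/-- Averages of characteristics converge faster than the perturbations vanish. -/
theorem tendsto_avg_fst_div (hS : IsPerturbedSample μ ρ h x U) {f : X → ℝ} (hf : Measurable f)
    {C : ℝ} (hC : ∀ x, |f x| ≤ C) :
    Tendsto (fun y : ℕ × Ω => (avg (fun i => f (x y.1 i y.2)) - ∫ x, f x ∂ρ) / h y.1)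
      (inProbability μ) (𝓝 0) := by
  have := hS.tendsto_avg (g := fun n z => (h n)⁻¹ * (f z.1 * 1)) (C := C)
    (fun n => by fun_prop) ?_
  · refine this.congr fun y => ?_
    rw [avg_const_mul, integral_const_mul, integral_fst_mul f (fun _ => 1)]
    simp only [mul_one, integral_const, probReal_univ, smul_eq_mul]
    ring
  · filter_upwards [hS.pos] with n hn
    refine Eventually.of_forall fun z => ?_
    rw [mul_one, abs_mul, abs_inv, abs_of_pos hn, div_eq_inv_mul]
    gcongr
    exact hC _

theorem tendsto_avg_fst (hS : IsPerturbedSample μ ρ h x U) {f : X → ℝ} (hf : Measurable f)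
    {C : ℝ} (hC : ∀ x, |f x| ≤ C) :
    Tendsto (fun y : ℕ × Ω => avg (fun i => f (x y.1 i y.2))) (inProbability μ)
      (𝓝 (∫ x, f x ∂ρ)) := by
  have h1 := ((hS.tendsto_avg_fst_div hf hC).mul hS.tendsto_size).add_const (∫ x, f x ∂ρ)
  simp only [mul_zero, zero_add] at h1
  refine h1.congr' ?_
  filter_upwards [hS.eventually_pos] with y hy
  field_simp
  ring

/-- The perturbation is centred and independent of `x`, so the mean vanishes. Since `|U| = h`, the
normalized summand is at most `C / h`. -/
theorem tendsto_avg_sign_div (hS : IsPerturbedSample μ ρ h x U) {f : X → ℝ} (hf : Measurable f)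
    {C : ℝ} (hC : ∀ x, |f x| ≤ C) (j : Fin J) :
    Tendsto (fun y : ℕ × Ω => avg (fun i => f (x y.1 i y.2) * U y.1 i y.2 j) / h y.1 ^ 2)
      (inProbability μ) (𝓝 0) := by
  have := hS.tendsto_avg (g := fun n z => (h n ^ 2)⁻¹ * (f z.1 * z.2 j)) (C := C)
    (fun n => by fun_prop) ?_
  · refine this.congr fun y => ?_
    rw [avg_const_mul, integral_const_mul, integral_fst_mul f (fun v => v j),
      integral_perturbationLaw]
    ring
  · filter_upwards [hS.pos] with n hn
    have h1 : ∀ᵐ y ∂(ρ.prod (perturbationLaw J (h n))), ∀ j, |y.2 j| = |h n| :=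
      Measure.quasiMeasurePreserving_snd.ae (ae_perturbationLaw J (h n))
    filter_upwards [h1] with z hz
    rw [abs_mul, abs_mul, hz j, abs_inv, abs_pow, abs_of_pos hn]
    have : (h n ^ 2)⁻¹ * (|f z.1| * h n) = |f z.1| / h n := by field_simp
    rw [this]
    gcongr
    exact hC _

theorem tendsto_avg_sign_mul_sign (hS : IsPerturbedSample μ ρ h x U) {f : X → ℝ}
    (hf : Measurable f) {C : ℝ} (hC : ∀ x, |f x| ≤ C) (j m : Fin J) :
    Tendsto (fun y : ℕ × Ω =>
        avg (fun i => f (x y.1 i y.2) * (U y.1 i y.2 j * U y.1 i y.2 m)) / h y.1 ^ 2)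
      (inProbability μ) (𝓝 (if j = m then ∫ x, f x ∂ρ else 0)) := by
  have := hS.tendsto_avg (g := fun n z => (h n ^ 2)⁻¹ * (f z.1 * (z.2 j * z.2 m))) (C := C)
    (fun n => by fun_prop) ?_
  · have h2 := this.add_const (if j = m then ∫ x, f x ∂ρ else 0)
    rw [zero_add] at h2
    refine h2.congr' ?_
    filter_upwards [hS.eventually_pos] with y hy
    rw [avg_const_mul, integral_const_mul, integral_fst_mul f (fun v => v j * v m),
      integral_perturbationLaw_mul]
    split_ifs
    · field_simp
      ring
    · simp [div_eq_inv_mul]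
  -- Here the normalized summand is bounded by `C`, and `h n ≤ 1` turns this into the bound `C / h
  -- n`.
  · filter_upwards [hS.pos, hS.tendsto_zero.eventually (Iic_mem_nhds one_pos)] with n hn hn1
    have h1 : ∀ᵐ y ∂(ρ.prod (perturbationLaw J (h n))), ∀ j, |y.2 j| = |h n| :=
      Measure.quasiMeasurePreserving_snd.ae (ae_perturbationLaw J (h n))
    filter_upwards [h1] with z hz
    rw [abs_mul, abs_mul, abs_mul, hz j, hz m, abs_inv, abs_pow, abs_of_pos hn]
    have : (h n ^ 2)⁻¹ * (|f z.1| * (h n * h n)) = |f z.1| := by field_simp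
    rw [this, le_div_iff₀ hn]
    have : |f z.1| * h n ≤ |f z.1| * 1 := by gcongr
    linarith [hC z.1]

end IsPerturbedSample

/-! ### Families of functions that are uniformly `C^{1,1}` on an open set -/

/-- A measurable family of functions, differentiable on `O`, such that the functions, their
derivatives and the Lipschitz constants of the derivatives are bounded by `C` on `O`. -/
structure IsUniformlyC11 {X : Type*} [MeasurableSpace X] {J : ℕ} (f : X → Price J → ℝ)
    (O : Set (Price J)) (C : ℝ) : Prop where
  measurable : ∀ p, Measurable fun x => f x p
  differentiableAt : ∀ x, ∀ p ∈ O, DifferentiableAt ℝ (f x) p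
  bound : ∀ x, ∀ p ∈ O, |f x p| ≤ C
  fderiv_bound : ∀ x, ∀ p ∈ O, ‖fderiv ℝ (f x) p‖ ≤ C
  fderiv_lip : ∀ x, ∀ p ∈ O, ∀ q ∈ O, ‖fderiv ℝ (f x) p - fderiv ℝ (f x) q‖ ≤ C * ‖p - q‖

theorem fderiv_apply_eq_sum {J : ℕ} (L : Price J →L[ℝ] ℝ) (v : Price J) :
    L v = ∑ m, L (EuclideanSpace.single m 1) * v m := by
  conv_lhs => rw [← (EuclideanSpace.basisFun (Fin J) ℝ).sum_repr v]
  simp [map_sum, mul_comm]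

theorem norm_single_one {J : ℕ} (j : Fin J) : ‖(EuclideanSpace.single j 1 : Price J)‖ = 1 := by
  simp

theorem abs_apply_le_norm {J : ℕ} (v : Price J) (j : Fin J) : |v j| ≤ ‖v‖ := by
  simpa using PiLp.norm_apply_le v j

theorem norm_le_sum_abs {J : ℕ} (v : Price J) : ‖v‖ ≤ ∑ j, |v j| := by
  conv_lhs => rw [← (EuclideanSpace.basisFun (Fin J) ℝ).sum_repr v]
  refine (norm_sum_le _ _).trans (Finset.sum_le_sum fun j _ => ?_)
  simp [norm_smul]

theorem norm_le_of_abs_le {J : ℕ} {v : Price J} {K : ℝ} (h : ∀ j, |v j| ≤ K) : ‖v‖ ≤ J * K :=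
  (norm_le_sum_abs v).trans ((Finset.sum_le_sum fun j _ => h j).trans (by simp))

namespace IsUniformlyC11

variable {X : Type*} [MeasurableSpace X] {J : ℕ} {f : X → Price J → ℝ} {O : Set (Price J)} {C : ℝ}

/-- Mean value inequality for `f - f'(p₀)` on `O ∩ closedBall p₀ r`, where its derivative is at most
`C * r`. Freezing the derivative at `p₀` means that a law of large numbers at this one point
controls all increments nearby. -/
theorem abs_sub_sub_fderiv_le (hf : IsUniformlyC11 f O C) (hO : Convex ℝ O) (x : X)
    {p₀ p q : Price J} (hp₀ : p₀ ∈ O) (hp : p ∈ O) (hq : q ∈ O) {r : ℝ} (hpr : ‖p - p₀‖ ≤ r)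
    (hqr : ‖q - p₀‖ ≤ r) (hC : 0 ≤ C) :
    |f x q - f x p - fderiv ℝ (f x) p₀ (q - p)| ≤ C * r * ‖q - p‖ := by
  have hs : Convex ℝ (O ∩ Metric.closedBall p₀ r) := hO.inter (convex_closedBall p₀ r)
  refine hs.norm_image_sub_le_of_norm_hasFDerivWithin_le' (f := f x) (f' := fderiv ℝ (f x))
    (fun y hy => (hf.differentiableAt x y hy.1).hasFDerivAt.hasFDerivWithinAt) (fun y hy => ?_)
    ⟨hp, mem_closedBall_iff_norm.2 hpr⟩ ⟨hq, mem_closedBall_iff_norm.2 hqr⟩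
  refine (hf.fderiv_lip x y hy.1 p₀ hp₀).trans ?_
  gcongr
  exact mem_closedBall_iff_norm.1 hy.2

theorem abs_taylor_le (hf : IsUniformlyC11 f O C) (hO : Convex ℝ O) (x : X)
    {p q : Price J} (hp : p ∈ O) (hq : q ∈ O) (hC : 0 ≤ C) :
    |f x q - f x p - fderiv ℝ (f x) p (q - p)| ≤ C * ‖q - p‖ ^ 2 := by
  have := hf.abs_sub_sub_fderiv_le hO x hp hp hq (r := ‖q - p‖) (by simp) le_rfl hC
  rwa [mul_assoc, ← sq] at this

theorem abs_sub_le (hf : IsUniformlyC11 f O C) (hO : Convex ℝ O) (x : X)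
    {p q : Price J} (hp : p ∈ O) (hq : q ∈ O) : |f x q - f x p| ≤ C * ‖q - p‖ :=
  hO.norm_image_sub_le_of_norm_fderiv_le (f := f x) (fun y hy => hf.differentiableAt x y hy)
    (fun y hy => hf.fderiv_bound x y hy) hp hq

/-- Measurability is assumed only for values at fixed prices; a directional derivative inherits it
as a limit of difference quotients. -/
theorem measurable_fderiv_apply (hf : IsUniformlyC11 f O C) {p : Price J} (hp : p ∈ O)
    (v : Price J) : Measurable fun x => fderiv ℝ (f x) p v := by
  refine measurable_of_tendsto_metrizable
    (f := fun (n : ℕ) x => (n : ℝ) • (f x (p + (n : ℝ)⁻¹ • v) - f x p)) ?_ ?_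
  · intro n
    have h1 := hf.measurable (p + (n : ℝ)⁻¹ • v)
    have h2 := hf.measurable p
    fun_prop
  · rw [tendsto_pi_nhds]
    intro x
    exact ((hf.differentiableAt x p hp).hasFDerivAt.lim_real v).comp tendsto_natCast_atTop_atTop

theorem measurable_fderiv (hf : IsUniformlyC11 f O C) {p : Price J} (hp : p ∈ O) :
    Measurable fun x => fderiv ℝ (f x) p := by
  have h1 : ∀ x, fderiv ℝ (f x) p = ∑ m, fderiv ℝ (f x) p (EuclideanSpace.single m 1) •
      (EuclideanSpace.proj m : Price J →L[ℝ] ℝ) := by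
    intro x
    ext v
    rw [fderiv_apply_eq_sum]
    simp
  rw [funext h1]
  exact Finset.measurable_sum _ fun m _ =>
    (hf.measurable_fderiv_apply hp _).smul_const _

variable (ρ : Measure X) [IsProbabilityMeasure ρ]

theorem integrable (hf : IsUniformlyC11 f O C) {p : Price J} (hp : p ∈ O) :
    Integrable (fun x => f x p) ρ :=
  Integrable.of_bound (hf.measurable p).aestronglyMeasurable C
    (Eventually.of_forall fun x => hf.bound x p hp)

theorem integrable_fderiv (hf : IsUniformlyC11 f O C) {p : Price J} (hp : p ∈ O) :
    Integrable (fun x => fderiv ℝ (f x) p) ρ :=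
  Integrable.of_bound (hf.measurable_fderiv hp).aestronglyMeasurable C
    (Eventually.of_forall fun x => hf.fderiv_bound x p hp)

theorem hasFDerivAt_integral (hf : IsUniformlyC11 f O C) (hO : IsOpen O) {p : Price J}
    (hp : p ∈ O) :
    HasFDerivAt (fun q => ∫ x, f x q ∂ρ) (∫ x, fderiv ℝ (f x) p ∂ρ) p :=
  hasFDerivAt_integral_of_dominated_of_fderiv_le (bound := fun _ => C)
    (F' := fun q x => fderiv ℝ (f x) q) (hO.mem_nhds hp)
    (Eventually.of_forall fun q => (hf.measurable q).aestronglyMeasurable)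
    (hf.integrable ρ hp) (hf.measurable_fderiv hp).aestronglyMeasurable
    (Eventually.of_forall fun x q hq => hf.fderiv_bound x q hq)
    (integrable_const _)
    (Eventually.of_forall fun x q hq => (hf.differentiableAt x q hq).hasFDerivAt)

theorem fderiv_integral_apply (hf : IsUniformlyC11 f O C) (hO : IsOpen O) {p : Price J}
    (hp : p ∈ O) (v : Price J) :
    fderiv ℝ (fun q => ∫ x, f x q ∂ρ) p v = ∫ x, fderiv ℝ (f x) p v ∂ρ := by
  rw [(hf.hasFDerivAt_integral ρ hO hp).fderiv,
    ContinuousLinearMap.integral_apply (hf.integrable_fderiv ρ hp)]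

/-- The mean of a uniformly `C^{1,1}` family is `C^{1,1}` with the same bounds. -/
theorem integral (hf : IsUniformlyC11 f O C) (hO : IsOpen O) :
    IsUniformlyC11 (fun (_ : Unit) q => ∫ x, f x q ∂ρ) O C where
  measurable p := measurable_const
  differentiableAt _ p hp := (hf.hasFDerivAt_integral ρ hO hp).differentiableAt
  bound _ p hp := by
    simpa using norm_integral_le_of_norm_le_const (μ := ρ)
      (Eventually.of_forall fun x => (Real.norm_eq_abs _).trans_le (hf.bound x p hp))
  fderiv_bound _ p hp := by
    rw [(hf.hasFDerivAt_integral ρ hO hp).fderiv]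
    simpa using norm_integral_le_of_norm_le_const (μ := ρ)
      (Eventually.of_forall fun x => hf.fderiv_bound x p hp)
  fderiv_lip _ p hp q hq := by
    rw [(hf.hasFDerivAt_integral ρ hO hp).fderiv, (hf.hasFDerivAt_integral ρ hO hq).fderiv,
      ← integral_sub (hf.integrable_fderiv ρ hp) (hf.integrable_fderiv ρ hq)]
    simpa using norm_integral_le_of_norm_le_const (μ := ρ)
      (Eventually.of_forall fun x => hf.fderiv_lip x p hp q hq)

end IsUniformlyC11

/-- Bounds on the derivatives of orders at most two make a family uniformly `C^{1,1}`. -/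
theorem IsUniformlyC11.of_contDiff {X : Type*} [MeasurableSpace X] {J : ℕ}
    {f : X → Price J → ℝ} {O : Set (Price J)} {C : ℝ} (hO : Convex ℝ O)
    (hm : ∀ p, Measurable fun x => f x p) (hf : ∀ x, ContDiff ℝ 2 (f x))
    (hb : ∀ x, ∀ p ∈ O, ∀ r ≤ 2, ‖iteratedFDeriv ℝ r (f x) p‖ ≤ C) : IsUniformlyC11 f O C where
  measurable := hm
  differentiableAt x p _ := (hf x).differentiable (by norm_num) p
  bound x p hp := by simpa using hb x p hp 0 (by norm_num)
  fderiv_bound x p hp := by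
    rw [← norm_iteratedFDeriv_one]
    exact hb x p hp 1 (by norm_num)
  fderiv_lip x p hp q hq := by
    have h1 : ContDiff ℝ 1 (fderiv ℝ (f x)) := (hf x).fderiv_right (by norm_num)
    refine hO.norm_image_sub_le_of_norm_fderiv_le (𝕜 := ℝ) (f := fderiv ℝ (f x))
      (fun y _ => h1.differentiable (by norm_num) y) (fun y hy => ?_) hq hp
    rw [← norm_iteratedFDeriv_one, norm_iteratedFDeriv_fderiv]
    exact hb x y hy 2 le_rfl

/-! ### The box of prices -/

section PriceBox

variable {J : ℕ} {l u : Price J}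

theorem convex_priceBox (l u : Price J) : Convex ℝ (priceBox l u) := by
  intro p hp q hq a b ha hb hab j
  simp only [PiLp.add_apply, PiLp.smul_apply, smul_eq_mul]
  have h1 := hp j
  have h2 := hq j
  have : a = 1 - b := by linarith
  subst this
  constructor <;> nlinarith

theorem isClosed_priceBox (l u : Price J) : IsClosed (priceBox l u) := by
  have : priceBox l u = ⋂ j, {p : Price J | l j ≤ p j ∧ p j ≤ u j} := by
    ext p; simp [priceBox]
  rw [this]
  refine isClosed_iInter fun j => ?_
  have hc : Continuous fun p : Price J => p j := by fun_prop
  exact (isClosed_le continuous_const hc).inter (isClosed_le hc continuous_const)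

theorem isCompact_priceBox (l u : Price J) : IsCompact (priceBox l u) := by
  refine Metric.isCompact_of_isClosed_isBounded (isClosed_priceBox l u) ?_
  refine (Metric.isBounded_closedBall (x := (0 : Price J)) (r := ∑ j, (|l j| + |u j|))).subset ?_
  intro p hp
  rw [mem_closedBall_zero_iff]
  refine (norm_le_sum_abs p).trans (Finset.sum_le_sum fun j _ => ?_)
  rw [abs_le]
  have := hp j
  constructor
  · linarith [neg_abs_le (l j), abs_nonneg (u j)]
  · linarith [le_abs_self (u j), abs_nonneg (l j)]

/-- The price vector of the box closest to `p`. -/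
noncomputable def boxClamp (l u p : Price J) : Price J :=
  WithLp.toLp 2 fun j => max (l j) (min (p j) (u j))

theorem boxClamp_mem (hlu : ∀ j, l j ≤ u j) (p : Price J) : boxClamp l u p ∈ priceBox l u :=
  fun j => ⟨le_max_left _ _, max_le (hlu j) (min_le_right _ _)⟩

theorem norm_sub_boxClamp_le (hlu : ∀ j, l j ≤ u j) {p : Price J} {h : ℝ} (hh : 0 ≤ h)
    (hp : ∀ j, l j - h ≤ p j ∧ p j ≤ u j + h) : ‖p - boxClamp l u p‖ ≤ J * h := by
  refine norm_le_of_abs_le fun j => ?_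
  have h1 := hp j
  have h2 := hlu j
  simp only [boxClamp, PiLp.sub_apply]
  rw [abs_le]
  rcases max_cases (l j) (min (p j) (u j)) with h3 | h3 <;>
  rcases min_cases (p j) (u j) with h4 | h4 <;> constructor <;> linarith

end PriceBox

/-! ### Contractions -/

theorem exists_fixedPoint_of_contraction {E : Type*} [NormedAddCommGroup E] [CompleteSpace E]
    {s : Set E} (hs : IsClosed s) (hne : s.Nonempty) {T : E → E} (hT : Set.MapsTo T s s) {κ : ℝ}
    (hκ : κ < 1) (hTκ : ∀ p ∈ s, ∀ q ∈ s, ‖T p - T q‖ ≤ κ * ‖p - q‖) : ∃ p ∈ s, T p = p := by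
  obtain ⟨x, hx⟩ := hne
  have hc : ContractingWith κ.toNNReal (hT.restrict T s s) := by
    refine ⟨by simpa using hκ, LipschitzWith.of_dist_le_mul fun p q => ?_⟩
    rw [Subtype.dist_eq, Subtype.dist_eq, dist_eq_norm, dist_eq_norm]
    refine (hTκ p p.2 q q.2).trans ?_
    gcongr
    exact Real.le_coe_toNNReal κ
  obtain ⟨p, hp, hfix, -⟩ := hc.exists_fixedPoint' hs.isComplete hT hx (edist_ne_top _ _)
  exact ⟨p, hp, hfix⟩

/-- Quantitative injectivity: the residual `z p` controls the distance from `p` to a zero. It serves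
for uniqueness, for continuity in `π`, and for the rate of the market price. -/
theorem norm_sub_le_of_contraction {E : Type*} [NormedAddCommGroup E] {z : E → E} {κ : ℝ}
    {p q : E} (h : ‖(z p + p) - (z q + q)‖ ≤ κ * ‖p - q‖) (hq : z q = 0) :
    (1 - κ) * ‖p - q‖ ≤ ‖z p‖ := by
  have h1 : p - q = ((z p + p) - (z q + q)) - z p := by rw [hq]; abel
  have h2 : ‖p - q‖ ≤ ‖(z p + p) - (z q + q)‖ + ‖z p‖ := by
    conv_lhs => rw [h1]
    exact norm_sub_le _ _
  linarith

/-- A function `z` for which `z + id` is a contraction of a box, and which points into the box on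
its boundary, has a unique zero in the box. -/
theorem existsUnique_zero_of_contraction {J : ℕ} {l u : Price J} (hlu : ∀ j, l j ≤ u j)
    {z : Price J → Price J} {κ : ℝ} (hκ : κ < 1)
    (hz : ∀ p ∈ priceBox l u, ∀ q ∈ priceBox l u, ‖(z p + p) - (z q + q)‖ ≤ κ * ‖p - q‖)
    (hup : ∀ p ∈ priceBox l u, ∀ j, p j = u j → z p j ≤ 0)
    (hlow : ∀ p ∈ priceBox l u, ∀ j, p j = l j → 0 ≤ z p j) :
    ∃! p, p ∈ priceBox l u ∧ z p = 0 := by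
  -- Slide `p` along the `j`-th axis to the level `a`. As `κ < 1`, the `j`-th coordinate of `z + id`
  -- changes by no more than the distance moved.
  have hmove : ∀ p ∈ priceBox l u, ∀ j (a : ℝ), l j ≤ a → a ≤ u j →
      ∃ q ∈ priceBox l u, q j = a ∧ |z p j + p j - (z q j + a)| ≤ |p j - a| := by
    intro p hp j a hla hau
    have hqj : (p + (a - p j) • EuclideanSpace.single j 1 : Price J) j = a := by simp
    have hq : p + (a - p j) • EuclideanSpace.single j 1 ∈ priceBox l u := by
      intro i
      by_cases hij : i = j
      · subst hij; rw [hqj]; exact ⟨hla, hau⟩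
      · simpa [hij] using hp i
    refine ⟨_, hq, hqj, ?_⟩
    have h1 := hz p hp _ hq
    have h2 := abs_apply_le_norm ((z p + p) - (z (p + (a - p j) • EuclideanSpace.single j 1) +
      (p + (a - p j) • EuclideanSpace.single j 1))) j
    have h3 : ‖p - (p + (a - p j) • EuclideanSpace.single j 1)‖ = |p j - a| := by
      rw [sub_add_cancel_left, norm_neg, norm_smul, norm_single_one, mul_one, Real.norm_eq_abs,
        abs_sub_comm]
    rw [h3] at h1
    rw [PiLp.sub_apply, PiLp.add_apply, PiLp.add_apply, hqj] at h2
    refine h2.trans (h1.trans ?_)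
    nlinarith [abs_nonneg (p j - a)]
  -- Why the factor is one half: comparison with the lower face gives only `z p j ≥ 2 (l j - p j)`,
  -- and symmetrically above. The undamped map `p + z p` could therefore leave the box.
  have hT : Set.MapsTo (fun p => p + (2⁻¹ : ℝ) • z p) (priceBox l u) (priceBox l u) := by
    intro p hp j
    simp only [PiLp.add_apply, PiLp.smul_apply, smul_eq_mul]
    constructor
    · obtain ⟨q, hq, hqj, h1⟩ := hmove p hp j (l j) le_rfl (hlu j)
      have h2 := hlow q hq j hqj
      rw [abs_of_nonneg (sub_nonneg.2 (hp j).1)] at h1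
      linarith [neg_le_of_abs_le h1]
    · obtain ⟨q, hq, hqj, h1⟩ := hmove p hp j (u j) (hlu j) le_rfl
      have h2 := hup q hq j hqj
      rw [abs_of_nonpos (sub_nonpos.2 (hp j).2)] at h1
      linarith [le_of_abs_le h1]
  have hne : (priceBox l u).Nonempty := ⟨l, fun j => ⟨le_rfl, hlu j⟩⟩
  obtain ⟨p, hp, hfix⟩ := exists_fixedPoint_of_contraction (isClosed_priceBox l u) hne hT
    (κ := (1 + κ) / 2) (by linarith) (fun p hp q hq => by
      have h1 : (p + (2⁻¹ : ℝ) • z p) - (q + (2⁻¹ : ℝ) • z q) =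
          (2⁻¹ : ℝ) • (p - q) + (2⁻¹ : ℝ) • ((z p + p) - (z q + q)) := by
        module
      rw [h1]
      refine (norm_add_le _ _).trans ?_
      rw [norm_smul, norm_smul]
      have := hz p hp q hq
      norm_num
      linarith)
  have hzp : z p = 0 := by
    have : (2⁻¹ : ℝ) • z p = 0 := by simpa using hfix
    simpa using this
  refine ⟨p, ⟨hp, hzp⟩, fun q hq => ?_⟩
  have h1 := norm_sub_le_of_contraction (hz q hq.1 p hp) hzp
  rw [hq.2, norm_zero] at h1
  have h2 : ‖q - p‖ ≤ 0 := by
    by_contra hc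
    push Not at hc
    nlinarith
  exact sub_eq_zero.1 (norm_le_zero_iff.1 h2)

/-- Implicit differentiation of the zeros `f s` of `z + (s - t) • τ`. -/
theorem hasDerivAt_of_implicit {E : Type*} [NormedAddCommGroup E] [NormedSpace ℝ E] {f : ℝ → E}
    {z τ : E → E} {A B : E →L[ℝ] E} {t K : ℝ} (hA : HasFDerivAt z A (f t))
    (hBA : ∀ v, B (A v) = v) (hf : ∀ᶠ s in 𝓝 t, ‖f s - f t‖ ≤ K * |s - t|)
    (hτ : Tendsto (fun s => τ (f s)) (𝓝 t) (𝓝 (τ (f t)))) (hzt : z (f t) = 0)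
    (hz : ∀ᶠ s in 𝓝 t, z (f s) + (s - t) • τ (f s) = 0) :
    HasDerivAt f (-B (τ (f t))) t := by
  have hO : (fun s => f s - f t) =O[𝓝 t] fun s => s - t :=
    Asymptotics.IsBigO.of_bound K hf
  have hcont : Tendsto f (𝓝 t) (𝓝 (f t)) := by
    have h0 : Tendsto (fun s : ℝ => s - t) (𝓝 t) (𝓝 0) := by
      have : Tendsto (fun s : ℝ => s - t) (𝓝 t) (𝓝 (t - t)) := tendsto_id.sub_const t
      simpa using this
    have := (hO.trans_tendsto h0).add_const (f t)
    simpa using this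
  have h1 : (fun s => z (f s) - z (f t) - A (f s - f t)) =o[𝓝 t] fun s => s - t :=
    (hA.isLittleO.comp_tendsto hcont).trans_isBigO hO
  have h2 : (fun s => (s - t) • (τ (f s) - τ (f t))) =o[𝓝 t] fun s => s - t := by
    have h3 : (fun s => τ (f s) - τ (f t)) =o[𝓝 t] fun _ => (1 : ℝ) := by
      rw [Asymptotics.isLittleO_one_iff]
      simpa using hτ.sub_const (τ (f t))
    simpa using (Asymptotics.isBigO_refl (fun s => s - t) (𝓝 t)).smul_isLittleO h3
  -- Applied to both errors together, the left inverse `B` leaves `-(f s - f t) - (s - t) • B (τ (f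
  -- t))`, because the perturbed equation at `s` cancels the remaining terms.
  have h4 := (B.isBigO_comp _ (𝓝 t)).trans_isLittleO (h1.add h2)
  rw [hasDerivAt_iff_isLittleO]
  refine h4.neg_left.congr' ?_ EventuallyEq.rfl
  filter_upwards [hz] with s hs
  have h5 : z (f s) - z (f t) - A (f s - f t) + (s - t) • (τ (f s) - τ (f t)) =
      (z (f s) + (s - t) • τ (f s)) - A (f s - f t) - (s - t) • τ (f t) := by
    rw [hzt]; module
  rw [h5, hs]
  simp only [map_sub, map_smul, hBA, zero_sub, map_neg]
  module

namespace IsUniformlyC11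

theorem comp_measurable {X X' : Type*} [MeasurableSpace X] [MeasurableSpace X'] {J : ℕ}
    {f : X → Price J → ℝ} {O : Set (Price J)} {C : ℝ} (hf : IsUniformlyC11 f O C) {g : X' → X}
    (hg : Measurable g) : IsUniformlyC11 (fun x => f (g x)) O C where
  measurable p := (hf.measurable p).comp hg
  differentiableAt x := hf.differentiableAt (g x)
  bound x := hf.bound (g x)
  fderiv_bound x := hf.fderiv_bound (g x)
  fderiv_lip x := hf.fderiv_lip (g x)

end IsUniformlyC11

/-! ### The mean-field market: contraction, unique price, derivative of the price. -/

namespace Market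

variable {Ξ : Type*} {J : ℕ} [MeasurableSpace Ξ] {M : Market Ξ J} {Θ : Measure Ξ} {l u : Price J}

/-- Otherwise the price vector `l` would be above the upper and below the lower bound for good `j`,
and a type with strict inequality would have excess demand of both signs there. -/
theorem HasPriceBounds.lower_lt_upper (hb : M.HasPriceBounds Θ l u) (j : Fin J) : l j < u j := by
  by_contra hc
  obtain ⟨A, -, hA, hlt⟩ := hb.upper_strict true j
  obtain ⟨ξ, hξ⟩ := nonempty_of_measure_ne_zero hA.ne'
  exact absurd (hb.lower ξ true j l le_rfl) (not_le.2 (hlt ξ hξ l (not_lt.1 hc)))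

theorem measurable_excess_apply (hm : M.IsMeasurable) (k : Fin J) (p : Price J) :
    Measurable fun x : Ξ × Bool => M.excess x.1 x.2 p k := by
  refine measurable_from_prod_countable_left fun w => ?_
  have h1 := (hm.demand w p).sub (hm.supply w p)
  exact (measurable_pi_apply k).comp ((WithLp.measurable_ofLp 2 _).comp h1)

/-- On a neighbourhood of the box, outcomes and excess demands are uniformly `C^{1,1}`, and demands
and supplies are integrable. -/
structure IsNice (M : Market Ξ J) (Θ : Measure Ξ) (O : Set (Price J)) (C : ℝ) : Prop where
  nonneg : 0 ≤ C
  isOpen : IsOpen O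
  convex : Convex ℝ O
  outcome : IsUniformlyC11 (fun x : Ξ × Bool => M.outcome x.1 x.2) O C
  excess : ∀ k, IsUniformlyC11 (fun (x : Ξ × Bool) p => M.excess x.1 x.2 p k) O C
  demand : ∀ w, ∀ p ∈ O, Integrable (fun ξ => M.demand ξ w p) Θ
  supply : ∀ w, ∀ p ∈ O, Integrable (fun ξ => M.supply ξ w p) Θ

theorem IsSmoothBounded.exists_isNice [IsProbabilityMeasure Θ] (hm : M.IsMeasurable)
    (hs : M.IsSmoothBounded l u) :
    ∃ δ > 0, ∃ C, M.IsNice Θ (Metric.thickening δ (priceBox l u)) C := by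
  obtain ⟨δ, hδ, C, hC⟩ := hs.bounded
  have hconv : Convex ℝ (Metric.thickening δ (priceBox l u)) := (convex_priceBox l u).thickening δ
  -- Excess demand is a difference of two functions bounded by `C`, whence the factor 2; the
  -- absolute value makes the constant visibly nonnegative.
  refine ⟨δ, hδ, 2 * |C|, ?_⟩
  have hCC : C ≤ 2 * |C| := by linarith [le_abs_self C, abs_nonneg C]
  have hex : ∀ ξ w, ContDiff ℝ 2 (M.excess ξ w) := fun ξ w => (hs.demand ξ w).sub (hs.supply ξ w)
  refine ⟨by positivity, Metric.isOpen_thickening, hconv, ?_, fun k => ?_, ?_, ?_⟩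
  · refine IsUniformlyC11.of_contDiff hconv ?_ (fun x => hs.outcome x.1 x.2)
      fun x p hp r hr => (hC x.1 x.2 p hp r hr).1.trans hCC
    exact fun p => measurable_from_prod_countable_left fun w => hm.outcome w p
  · refine IsUniformlyC11.of_contDiff hconv (measurable_excess_apply hm k)
      (fun x => (EuclideanSpace.proj (𝕜 := ℝ) k).contDiff.comp (hex x.1 x.2)) ?_
    intro x p hp r hr
    have hr' : (r : WithTop ℕ∞) ≤ 2 := by exact_mod_cast hr
    have h1 : ‖(EuclideanSpace.proj k : Price J →L[ℝ] ℝ)‖ ≤ 1 := by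
      refine ContinuousLinearMap.opNorm_le_bound _ zero_le_one fun v => ?_
      simpa using abs_apply_le_norm v k
    have h2 := ContinuousLinearMap.norm_iteratedFDeriv_comp_left
      (EuclideanSpace.proj k : Price J →L[ℝ] ℝ) (hex x.1 x.2).contDiffAt (x := p) hr'
    have h3 : iteratedFDeriv ℝ r (M.excess x.1 x.2) p =
        iteratedFDeriv ℝ r (M.demand x.1 x.2) p - iteratedFDeriv ℝ r (M.supply x.1 x.2) p :=
      iteratedFDeriv_sub_apply ((hs.demand x.1 x.2).of_le hr').contDiffAt
        ((hs.supply x.1 x.2).of_le hr').contDiffAt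
    have h4 := norm_sub_le (iteratedFDeriv ℝ r (M.demand x.1 x.2) p)
      (iteratedFDeriv ℝ r (M.supply x.1 x.2) p)
    rw [← h3] at h4
    obtain ⟨-, h5, h6⟩ := hC x.1 x.2 p hp r hr
    refine h2.trans ?_
    have h7 := norm_nonneg (iteratedFDeriv ℝ r (M.excess x.1 x.2) p)
    nlinarith [le_abs_self C]
  · exact fun w p hp => Integrable.of_bound (hm.demand w p).aestronglyMeasurable C
      (Eventually.of_forall fun ξ => by simpa using (hC ξ w p hp 0 (by norm_num)).2.1)
  · exact fun w p hp => Integrable.of_bound (hm.supply w p).aestronglyMeasurable C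
      (Eventually.of_forall fun ξ => by simpa using (hC ξ w p hp 0 (by norm_num)).2.2)

/-- Mean excess demand under treatment `w`. -/
noncomputable def meanExcess (M : Market Ξ J) (Θ : Measure Ξ) (w : Bool) (p : Price J) : Price J :=
  M.meanDemand Θ w p - M.meanSupply Θ w p

theorem mixedExcess_eq (M : Market Ξ J) (Θ : Measure Ξ) (π : ℝ) (p : Price J) :
    M.mixedExcess Θ π p = π • M.meanExcess Θ true p + (1 - π) • M.meanExcess Θ false p := rfl

/-- The derivative of `z_π(p)` in `π`. -/
noncomputable def excessEffect (M : Market Ξ J) (Θ : Measure Ξ) (p : Price J) : Price J :=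
  M.meanExcess Θ true p - M.meanExcess Θ false p

theorem mixedExcess_eq_add (M : Market Ξ J) (Θ : Measure Ξ) (π π' : ℝ) (p : Price J) :
    M.mixedExcess Θ π' p = M.mixedExcess Θ π p + (π' - π) • M.excessEffect Θ p := by
  rw [mixedExcess_eq, mixedExcess_eq, excessEffect]
  module

/-- The transpose appears because the rows of `excessGradient` are indexed by prices, whereas those
of a Jacobian are indexed by components. -/
theorem fderiv_mixedExcess_eq_mulVec (M : Market Ξ J) (Θ : Measure Ξ) (π : ℝ) (p v : Price J) :
    fderiv ℝ (M.mixedExcess Θ π) p v = WithLp.toLp 2 ((M.excessGradient Θ π p)ᵀ *ᵥ ⇑v) := by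
  ext k
  have h1 := fderiv_apply_eq_sum
    ((EuclideanSpace.proj (𝕜 := ℝ) k).comp (fderiv ℝ (M.mixedExcess Θ π) p)) v
  simpa [Matrix.mulVec, dotProduct, excessGradient] using h1

namespace IsNice

variable {O : Set (Price J)} {C : ℝ} {π : ℝ}

theorem meanExcess_apply (hN : M.IsNice Θ O C) {p : Price J} (hp : p ∈ O) (w : Bool) (k : Fin J) :
    M.meanExcess Θ w p k = ∫ ξ, M.excess ξ w p k ∂Θ := by
  have h1 : M.meanExcess Θ w p = ∫ ξ, M.excess ξ w p ∂Θ := by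
    simp only [meanExcess, meanDemand, meanSupply, Market.excess]
    rw [integral_sub (hN.demand w p hp) (hN.supply w p hp)]
  rw [h1]
  exact ((EuclideanSpace.proj (𝕜 := ℝ) k).integral_comp_comm
    ((hN.demand w p hp).sub (hN.supply w p hp))).symm

theorem excess_treatment (hN : M.IsNice Θ O C) (w : Bool) (k : Fin J) :
    IsUniformlyC11 (fun ξ p => M.excess ξ w p k) O C :=
  (hN.excess k).comp_measurable (g := fun ξ => (ξ, w)) (by fun_prop)

variable [IsProbabilityMeasure Θ]

/-- With the treatment counted among the individual characteristics, mixing over `π` is an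
expectation under one product law, to which the laws of large numbers apply. -/
theorem mixedExcess_apply (hN : M.IsNice Θ O C) (hπ : 0 < π ∧ π < 1) {p : Price J} (hp : p ∈ O)
    (k : Fin J) :
    M.mixedExcess Θ π p k = ∫ x, M.excess x.1 x.2 p k ∂(Θ.prod (treatmentLaw π)) := by
  have : IsProbabilityMeasure (treatmentLaw π) := isProbabilityMeasure_treatmentLaw hπ
  rw [integral_prod_treatmentLaw Θ hπ ((hN.excess k).integrable _ hp)
    fun w => (hN.excess_treatment w k).integrable _ hp, mixedExcess_eq]
  simp [hN.meanExcess_apply hp]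

theorem mixedOutcome_eq (hN : M.IsNice Θ O C) (hπ : 0 < π ∧ π < 1) {p : Price J} (hp : p ∈ O) :
    M.mixedOutcome Θ π p = ∫ x, M.outcome x.1 x.2 p ∂(Θ.prod (treatmentLaw π)) := by
  have : IsProbabilityMeasure (treatmentLaw π) := isProbabilityMeasure_treatmentLaw hπ
  rw [integral_prod_treatmentLaw Θ hπ (hN.outcome.integrable _ hp)
    fun w => (hN.outcome.comp_measurable (g := fun ξ => (ξ, w)) (by fun_prop)).integrable _ hp]
  rfl

theorem norm_meanExcess_sub_le (hN : M.IsNice Θ O C) {p q : Price J} (hp : p ∈ O) (hq : q ∈ O)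
    (w : Bool) : ‖M.meanExcess Θ w q - M.meanExcess Θ w p‖ ≤ J * (C * ‖q - p‖) := by
  refine norm_le_of_abs_le fun k => ?_
  rw [PiLp.sub_apply, hN.meanExcess_apply hp, hN.meanExcess_apply hq]
  exact ((hN.excess_treatment w k).integral Θ hN.isOpen).abs_sub_le hN.convex () hp hq

theorem norm_excessEffect_sub_le (hN : M.IsNice Θ O C) {p q : Price J} (hp : p ∈ O) (hq : q ∈ O) :
    ‖M.excessEffect Θ q - M.excessEffect Θ p‖ ≤ 2 * J * C * ‖q - p‖ := by
  have h1 := hN.norm_meanExcess_sub_le hp hq true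
  have h2 := hN.norm_meanExcess_sub_le hp hq false
  have h3 : M.excessEffect Θ q - M.excessEffect Θ p =
      (M.meanExcess Θ true q - M.meanExcess Θ true p) -
        (M.meanExcess Θ false q - M.meanExcess Θ false p) := by
    simp only [excessEffect]; abel
  rw [h3]
  refine (norm_sub_le _ _).trans ?_
  linarith

theorem hasFDerivAt_mixedExcess_apply (hN : M.IsNice Θ O C) (hπ : 0 < π ∧ π < 1) {p : Price J}
    (hp : p ∈ O) (k : Fin J) :
    HasFDerivAt (fun q => M.mixedExcess Θ π q k)
      (∫ x, fderiv ℝ (fun q => M.excess x.1 x.2 q k) p ∂(Θ.prod (treatmentLaw π))) p := by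
  have : IsProbabilityMeasure (treatmentLaw π) := isProbabilityMeasure_treatmentLaw hπ
  refine ((hN.excess k).hasFDerivAt_integral _ hN.isOpen hp).congr_of_eventuallyEq ?_
  filter_upwards [hN.isOpen.mem_nhds hp] with q hq
  exact hN.mixedExcess_apply hπ hq k

theorem differentiableAt_mixedExcess (hN : M.IsNice Θ O C) (hπ : 0 < π ∧ π < 1) {p : Price J}
    (hp : p ∈ O) : DifferentiableAt ℝ (M.mixedExcess Θ π) p :=
  differentiableAt_euclidean.2 fun k => (hN.hasFDerivAt_mixedExcess_apply hπ hp k).differentiableAt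

theorem fderiv_mixedExcess_apply (hN : M.IsNice Θ O C) (hπ : 0 < π ∧ π < 1) {p : Price J}
    (hp : p ∈ O) (k : Fin J) (v : Price J) :
    fderiv ℝ (M.mixedExcess Θ π) p v k =
      ∫ x, fderiv ℝ (fun q => M.excess x.1 x.2 q k) p v ∂(Θ.prod (treatmentLaw π)) := by
  have : IsProbabilityMeasure (treatmentLaw π) := isProbabilityMeasure_treatmentLaw hπ
  have h1 := (EuclideanSpace.proj (𝕜 := ℝ) k).hasFDerivAt.comp p
    (hN.differentiableAt_mixedExcess hπ hp).hasFDerivAt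
  have h2 := h1.unique (hN.hasFDerivAt_mixedExcess_apply hπ hp k)
  rw [← ContinuousLinearMap.integral_apply ((hN.excess k).integrable_fderiv _ hp), ← h2]
  rfl

theorem excessGradient_apply (hN : M.IsNice Θ O C) (hπ : 0 < π ∧ π < 1) {p : Price J}
    (hp : p ∈ O) (j k : Fin J) :
    M.excessGradient Θ π p j k =
      ∫ x, fderiv ℝ (fun q => M.excess x.1 x.2 q k) p (EuclideanSpace.single j 1)
        ∂(Θ.prod (treatmentLaw π)) :=
  hN.fderiv_mixedExcess_apply hπ hp k _

theorem outcomeGradient_apply (hN : M.IsNice Θ O C) (hπ : 0 < π ∧ π < 1) {p : Price J}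
    (hp : p ∈ O) (j : Fin J) :
    M.outcomeGradient Θ π p j =
      ∫ x, fderiv ℝ (M.outcome x.1 x.2) p (EuclideanSpace.single j 1)
        ∂(Θ.prod (treatmentLaw π)) := by
  have : IsProbabilityMeasure (treatmentLaw π) := isProbabilityMeasure_treatmentLaw hπ
  rw [outcomeGradient, ← hN.outcome.fderiv_integral_apply _ hN.isOpen hp]
  congr 1
  refine Filter.EventuallyEq.fderiv_eq ?_
  filter_upwards [hN.isOpen.mem_nhds hp] with q hq
  exact hN.mixedOutcome_eq hπ hq

theorem norm_fderiv_mixedExcess_sub_le (hN : M.IsNice Θ O C) (hπ : 0 < π ∧ π < 1) {p q : Price J}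
    (hp : p ∈ O) (hq : q ∈ O) :
    ‖fderiv ℝ (M.mixedExcess Θ π) p - fderiv ℝ (M.mixedExcess Θ π) q‖ ≤ J * (C * ‖p - q‖) := by
  have : IsProbabilityMeasure (treatmentLaw π) := isProbabilityMeasure_treatmentLaw hπ
  have hC := hN.nonneg
  refine ContinuousLinearMap.opNorm_le_bound _ (by positivity) fun v => ?_
  rw [mul_assoc]
  refine norm_le_of_abs_le fun k => ?_
  have h1 := (((hN.excess k).integral (Θ.prod (treatmentLaw π)) hN.isOpen).fderiv_lip () p hp q hq)
  have h2 := (fderiv ℝ (fun q => ∫ x, M.excess x.1 x.2 q k ∂(Θ.prod (treatmentLaw π))) p -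
    fderiv ℝ (fun q => ∫ x, M.excess x.1 x.2 q k ∂(Θ.prod (treatmentLaw π))) q).le_of_opNorm_le h1 v
  rw [_root_.sub_apply, (hN.excess k).fderiv_integral_apply _ hN.isOpen hp,
    (hN.excess k).fderiv_integral_apply _ hN.isOpen hq] at h2
  rw [_root_.sub_apply, PiLp.sub_apply, hN.fderiv_mixedExcess_apply hπ hp,
    hN.fderiv_mixedExcess_apply hπ hq]
  exact h2

/-- On the box, `z_π + id` is a contraction. -/
theorem exists_contraction (hN : M.IsNice Θ O C) (hπ : 0 < π ∧ π < 1) (hO : priceBox l u ⊆ O)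
    (hne : (priceBox l u).Nonempty)
    (hc : ∀ p ∈ priceBox l u, ‖fderiv ℝ (fun q => M.mixedExcess Θ π q + q) p‖ < 1) :
    ∃ κ < 1, 0 ≤ κ ∧ (∀ p ∈ priceBox l u, ‖fderiv ℝ (fun q => M.mixedExcess Θ π q + q) p‖ ≤ κ) ∧
      ∀ p ∈ priceBox l u, ∀ q ∈ priceBox l u,
      ‖(M.mixedExcess Θ π p + p) - (M.mixedExcess Θ π q + q)‖ ≤ κ * ‖p - q‖ := by
  have hd : ∀ p ∈ O, HasFDerivAt (fun q => M.mixedExcess Θ π q + q)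
      (fderiv ℝ (M.mixedExcess Θ π) p + ContinuousLinearMap.id ℝ _) p := fun p hp =>
    (hN.differentiableAt_mixedExcess hπ hp).hasFDerivAt.add (hasFDerivAt_id p)
  have hcont : ContinuousOn (fun p => ‖fderiv ℝ (fun q => M.mixedExcess Θ π q + q) p‖)
      (priceBox l u) := by
    have hlip : LipschitzOnWith (J * C.toNNReal)
        (fun p => fderiv ℝ (fun q => M.mixedExcess Θ π q + q) p) (priceBox l u) := by
      refine LipschitzOnWith.of_dist_le_mul fun p hp q hq => ?_
      rw [dist_eq_norm, dist_eq_norm, (hd p (hO hp)).fderiv, (hd q (hO hq)).fderiv,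
        add_sub_add_right_eq_sub]
      refine (hN.norm_fderiv_mixedExcess_sub_le hπ (hO hp) (hO hq)).trans (le_of_eq ?_)
      simp [hN.nonneg]
      ring
    exact hlip.continuousOn.norm
  -- Compactness upgrades the pointwise bound `< 1` to a uniform one: the maximum of the norm is
  -- attained.
  obtain ⟨p₀, hp₀, hmax⟩ := (isCompact_priceBox l u).exists_isMaxOn hne hcont
  refine ⟨_, hc p₀ hp₀, norm_nonneg _, fun p hp => hmax hp, fun p hp q hq => ?_⟩
  exact (convex_priceBox l u).norm_image_sub_le_of_norm_fderiv_le
    (fun y hy => (hd y (hO hy)).differentiableAt) (fun y hy => hmax hy) hq hp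

theorem mixedExcess_nonpos (hN : M.IsNice Θ O C) (hb : M.HasPriceBounds Θ l u)
    (hπ : 0 < π ∧ π < 1) {p : Price J} (hp : p ∈ O) {j : Fin J} (hj : u j ≤ p j) :
    M.mixedExcess Θ π p j ≤ 0 := by
  rw [hN.mixedExcess_apply hπ hp]
  exact integral_nonpos fun x => hb.upper x.1 x.2 j p hj

theorem mixedExcess_nonneg (hN : M.IsNice Θ O C) (hb : M.HasPriceBounds Θ l u)
    (hπ : 0 < π ∧ π < 1) {p : Price J} (hp : p ∈ O) {j : Fin J} (hj : p j ≤ l j) :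
    0 ≤ M.mixedExcess Θ π p j := by
  rw [hN.mixedExcess_apply hπ hp]
  exact integral_nonneg fun x => hb.lower x.1 x.2 j p hj

theorem existsUnique_isMeanFieldPrice (hN : M.IsNice Θ O C) (hb : M.HasPriceBounds Θ l u)
    (hπ : 0 < π ∧ π < 1) (hO : priceBox l u ⊆ O) {κ : ℝ} (hκ : κ < 1)
    (hc : ∀ p ∈ priceBox l u, ∀ q ∈ priceBox l u,
      ‖(M.mixedExcess Θ π p + p) - (M.mixedExcess Θ π q + q)‖ ≤ κ * ‖p - q‖) :
    ∃! p, M.IsMeanFieldPrice Θ l u π p :=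
  existsUnique_zero_of_contraction (fun j => (hb.lower_lt_upper j).le) hκ hc
    (fun _ hp _ hj => hN.mixedExcess_nonpos hb hπ (hO hp) hj.ge)
    (fun _ hp _ hj => hN.mixedExcess_nonneg hb hπ (hO hp) hj.le)

/-- The mean-field price is differentiable in the treatment probability. -/
theorem hasDerivAt_meanFieldPrice (hN : M.IsNice Θ O C) (hb : M.HasPriceBounds Θ l u)
    (hπ : 0 < π ∧ π < 1) (hO : priceBox l u ⊆ O) {κ : ℝ} (hκ : κ < 1)
    (hc : ∀ p ∈ priceBox l u, ∀ q ∈ priceBox l u,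
      ‖(M.mixedExcess Θ π p + p) - (M.mixedExcess Θ π q + q)‖ ≤ κ * ‖p - q‖)
    (hJ : IsUnit (M.excessGradient Θ π (M.meanFieldPrice Θ l u π))) :
    HasDerivAt (M.meanFieldPrice Θ l u)
      (-WithLp.toLp 2 (((M.excessGradient Θ π (M.meanFieldPrice Θ l u π))ᵀ)⁻¹ *ᵥ
        ⇑(M.excessEffect Θ (M.meanFieldPrice Θ l u π)))) π := by
  have hC := hN.nonneg
  set K := 2 * J * C with hK
  have hK0 : 0 ≤ K := by positivity
  have hspec : ∀ {π'}, (∃! p, M.IsMeanFieldPrice Θ l u π' p) →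
      M.IsMeanFieldPrice Θ l u π' (M.meanFieldPrice Θ l u π') := fun h =>
    Classical.epsilon_spec h.exists
  have h0 := hspec (hN.existsUnique_isMeanFieldPrice hb hπ hO hκ hc)
  -- Changing `π` adds a multiple of a `K`-Lipschitz map, so the contraction constant grows by at
  -- most `|π' - π| * K`. Prices therefore exist and are unique for all `π'` near `π`, as
  -- differentiating at `π` requires.
  have hc' : ∀ π', ∀ p ∈ priceBox l u, ∀ q ∈ priceBox l u,
      ‖(M.mixedExcess Θ π' p + p) - (M.mixedExcess Θ π' q + q)‖ ≤
        (κ + |π' - π| * K) * ‖p - q‖ := by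
    intro π' p hp q hq
    have h1 : (M.mixedExcess Θ π' p + p) - (M.mixedExcess Θ π' q + q) =
        ((M.mixedExcess Θ π p + p) - (M.mixedExcess Θ π q + q)) +
          (π' - π) • (M.excessEffect Θ p - M.excessEffect Θ q) := by
      rw [M.mixedExcess_eq_add Θ π π' p, M.mixedExcess_eq_add Θ π π' q]
      module
    rw [h1, add_mul, mul_assoc]
    refine (norm_add_le _ _).trans (add_le_add (hc p hp q hq) ?_)
    rw [norm_smul, Real.norm_eq_abs]
    gcongr
    exact hN.norm_excessEffect_sub_le (hO hq) (hO hp)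
  have hlim : Tendsto (fun π' => κ + |π' - π| * K) (𝓝 π) (𝓝 κ) := by
    have : Continuous fun π' => κ + |π' - π| * K := by fun_prop
    simpa using this.tendsto π
  have hev : ∀ᶠ π' in 𝓝 π, M.IsMeanFieldPrice Θ l u π' (M.meanFieldPrice Θ l u π') := by
    filter_upwards [hlim.eventually (gt_mem_nhds hκ), lt_mem_nhds hπ.1, gt_mem_nhds hπ.2]
      with π' h1 h2 h3
    exact hspec (hN.existsUnique_isMeanFieldPrice hb ⟨h2, h3⟩ hO h1 (hc' π'))
  -- At the old price the new excess demand is `(π' - π) • τ`. For `π'` near `π` the contraction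
  -- constant is below `(κ + 1) / 2`, so this residual bounds the movement of the price.
  have hnear : ∀ᶠ π' in 𝓝 π, ‖M.meanFieldPrice Θ l u π' - M.meanFieldPrice Θ l u π‖ ≤
      ((1 - (κ + 1) / 2)⁻¹ * ‖M.excessEffect Θ (M.meanFieldPrice Θ l u π)‖) * |π' - π| := by
    filter_upwards [hev, hlim.eventually (gt_mem_nhds (show κ < (κ + 1) / 2 by linarith))]
      with π' h1 h2
    have h3 := norm_sub_le_of_contraction (hc' π' _ h0.1 _ h1.1) h1.2
    rw [M.mixedExcess_eq_add Θ π π', h0.2, zero_add, norm_smul, Real.norm_eq_abs,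
      norm_sub_rev] at h3
    rw [mul_assoc, ← div_eq_inv_mul, le_div_iff₀ (by linarith)]
    nlinarith [norm_nonneg (M.meanFieldPrice Θ l u π' - M.meanFieldPrice Θ l u π)]
  have hdet : IsUnit ((M.excessGradient Θ π (M.meanFieldPrice Θ l u π))ᵀ).det := by
    rw [Matrix.det_transpose]
    exact (Matrix.isUnit_iff_isUnit_det _).1 hJ
  have key := hasDerivAt_of_implicit (f := M.meanFieldPrice Θ l u) (z := M.mixedExcess Θ π)
    (τ := M.excessEffect Θ) (t := π)
    (B := Matrix.toEuclideanCLM (n := Fin J) (𝕜 := ℝ)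
      ((M.excessGradient Θ π (M.meanFieldPrice Θ l u π))ᵀ)⁻¹)
    (hN.differentiableAt_mixedExcess hπ (hO h0.1)).hasFDerivAt
    (fun v => by
      rw [fderiv_mixedExcess_eq_mulVec, Matrix.toEuclideanCLM_toLp,
        Matrix.mulVec_mulVec, Matrix.nonsing_inv_mul _ hdet, Matrix.one_mulVec])
    hnear ?_ h0.2 ?_
  · rw [← Matrix.toEuclideanCLM_toLp]
    exact key
  · rw [tendsto_iff_norm_sub_tendsto_zero]
    have h1 : Tendsto (fun π' => K * (((1 - (κ + 1) / 2)⁻¹ *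
        ‖M.excessEffect Θ (M.meanFieldPrice Θ l u π)‖) * |π' - π|)) (𝓝 π) (𝓝 0) := by
      have : Continuous fun π' => K * (((1 - (κ + 1) / 2)⁻¹ *
        ‖M.excessEffect Θ (M.meanFieldPrice Θ l u π)‖) * |π' - π|) := by fun_prop
      simpa using this.tendsto π
    refine squeeze_zero' (Eventually.of_forall fun _ => norm_nonneg _) ?_ h1
    filter_upwards [hev, hnear] with π' h2 h3
    refine (hN.norm_excessEffect_sub_le (hO h0.1) (hO h2.1)).trans ?_
    gcongr
  · filter_upwards [hev] with π' h2
    rw [← M.mixedExcess_eq_add Θ π π']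
    exact h2.2

end IsNice

end Market

/-- The vector of perturbations has size at most `J * h`. -/
theorem norm_toLp_le_of_abs_eq {J : ℕ} {v : Fin J → ℝ} {h : ℝ} (hv : ∀ j, |v j| = h) :
    ‖(WithLp.toLp 2 v : Price J)‖ ≤ J * h :=
  norm_le_of_abs_le fun j => (hv j).le

namespace IsPerturbedSample

variable {Ω X : Type*} [MeasurableSpace Ω] [MeasurableSpace X] {J : ℕ} {μ : Measure Ω}
  {ρ : Measure X} {h : ℕ → ℝ} {x : (n : ℕ) → Fin n → Ω → X}
  {U : (n : ℕ) → Fin n → Ω → Fin J → ℝ} [IsProbabilityMeasure μ] [IsProbabilityMeasure ρ]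
  {f : X → Price J → ℝ} {O : Set (Price J)} {C : ℝ}

/-- Uniform law of large numbers on compact sets of prices. -/
theorem eventually_abs_avg_sub_integral_le (hS : IsPerturbedSample μ ρ h x U)
    (hf : IsUniformlyC11 f O C) (hO : Convex ℝ O) (hOo : IsOpen O) (hC : 0 ≤ C)
    {s : Set (Price J)} (hs : IsCompact s) (hsO : s ⊆ O) {ε : ℝ} (hε : 0 < ε) :
    ∀ᶠ y : ℕ × Ω in inProbability μ, ∀ p ∈ s,
      |avg (fun i => f (x y.1 i y.2) p) - ∫ z, f z p ∂ρ| ≤ ε := by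
  -- The radius of the finite net makes both the sample average and the mean vary by at most `ε / 4`
  -- within a ball; `C + 1` avoids division by zero.
  obtain ⟨t, hts, htf, hcover⟩ := hs.finite_cover_balls (e := ε / (4 * (C + 1))) (by positivity)
  have h1 : ∀ᶠ y : ℕ × Ω in inProbability μ, ∀ q ∈ t,
      |avg (fun i => f (x y.1 i y.2) q) - ∫ z, f z q ∂ρ| < ε / 2 := by
    rw [eventually_all_finite htf]
    intro q hq
    have h2 := hS.tendsto_avg_fst (hf.measurable q) (fun z => hf.bound z q (hsO (hts hq)))
    exact h2.eventually (Metric.ball_mem_nhds _ (half_pos hε))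
  filter_upwards [h1] with y hy p hp
  obtain ⟨q, hq, hpq⟩ := Set.mem_iUnion₂.1 (hcover hp)
  have hqO := hsO (hts hq)
  have hpO := hsO hp
  have hd : C * ‖p - q‖ ≤ ε / 4 := by
    have h3 : ‖p - q‖ ≤ ε / (4 * (C + 1)) := (mem_ball_iff_norm.1 hpq).le
    calc C * ‖p - q‖ ≤ (C + 1) * (ε / (4 * (C + 1))) := by gcongr; linarith
      _ = ε / 4 := by field_simp
  have h4 : |avg (fun i => f (x y.1 i y.2) p) - avg (fun i => f (x y.1 i y.2) q)| ≤ ε / 4 :=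
    abs_avg_sub_avg_le (by linarith) fun i => (hf.abs_sub_le hO _ hqO hpO).trans hd
  have h5 : |∫ z, f z p ∂ρ - ∫ z, f z q ∂ρ| ≤ ε / 4 :=
    ((hf.integral ρ hOo).abs_sub_le hO () hqO hpO).trans hd
  have h6 := hy q hq
  rw [abs_le] at *
  rw [abs_lt] at h6
  constructor <;> linarith [h4.1, h4.2, h5.1, h5.2, h6.1, h6.2]

end IsPerturbedSample

/-! ### The finite market: the market price is within `O(h_n)` of the mean-field price. -/

namespace Market

variable {Ξ : Type*} {J : ℕ}

theorem averageExcess_apply (M : Market Ξ J) {n : ℕ} (ξ : Fin n → Ξ) (W : Fin n → Bool)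
    (U : Fin n → Fin J → ℝ) (p : Price J) (k : Fin J) :
    M.averageExcess ξ W U p k =
      avg fun i => M.excess (ξ i) (W i) (p + WithLp.toLp 2 (U i)) k := by
  simp [averageExcess, avg]

/-- Average excess demand in a sample, as a function of the common part of the price. -/
noncomputable def sampleExcess {Ω : Type*} (M : Market Ξ J)
    (x : (n : ℕ) → Fin n → Ω → Ξ × Bool) (U : (n : ℕ) → Fin n → Ω → Fin J → ℝ) (y : ℕ × Ω) :
    Price J → Price J :=
  M.averageExcess (fun i => (x y.1 i y.2).1) (fun i => (x y.1 i y.2).2) (fun i => U y.1 i y.2)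

theorem sampleExcess_apply {Ω : Type*} (M : Market Ξ J)
    (x : (n : ℕ) → Fin n → Ω → Ξ × Bool) (U : (n : ℕ) → Fin n → Ω → Fin J → ℝ) (y : ℕ × Ω)
    (p : Price J) (k : Fin J) :
    M.sampleExcess x U y p k = avg fun i =>
      M.excess (x y.1 i y.2).1 (x y.1 i y.2).2 (p + WithLp.toLp 2 (U y.1 i y.2)) k :=
  M.averageExcess_apply _ _ _ _ _

section Box

variable [MeasurableSpace Ξ] {M : Market Ξ J} {Θ : Measure Ξ} {l u : Price J}
  {Ω : Type*} [MeasurableSpace Ω] {μ : Measure Ω} {π : ℝ} {h : ℕ → ℝ}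
  {x : (n : ℕ) → Fin n → Ω → Ξ × Bool} {U : (n : ℕ) → Fin n → Ω → Fin J → ℝ}
  [IsProbabilityMeasure Θ] [IsProbabilityMeasure μ]

/-- Large samples contain treated individuals of any class of types of positive probability. -/
theorem eventually_exists_treated (hπ : 0 < π ∧ π < 1)
    (hS : IsPerturbedSample μ (Θ.prod (treatmentLaw π)) h x U) {A : Set Ξ} (hA : MeasurableSet A)
    (hpos : 0 < Θ A) :
    ∀ᶠ y : ℕ × Ω in inProbability μ, ∃ i, (x y.1 i y.2).1 ∈ A ∧ (x y.1 i y.2).2 = true := by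
  have : IsProbabilityMeasure (treatmentLaw π) := isProbabilityMeasure_treatmentLaw hπ
  have hm : MeasurableSet (A ×ˢ {true} : Set (Ξ × Bool)) := hA.prod (measurableSet_singleton _)
  -- The sample frequency of treated individuals with type in `A` tends to `Θ A * π > 0`, so it
  -- cannot stay zero.
  have h1 := hS.tendsto_avg_fst (f := (A ×ˢ {true}).indicator fun _ => (1 : ℝ))
    (measurable_const.indicator hm) (C := 1) (fun z => by
      by_cases hz : z ∈ (A ×ˢ {true} : Set (Ξ × Bool)) <;>
        simp only [Set.indicator, hz, if_true, if_false] <;> norm_num)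
  have h2 : 0 < ∫ z, (A ×ˢ {true}).indicator (fun _ => (1 : ℝ)) z
      ∂(Θ.prod (treatmentLaw π)) := by
    rw [integral_indicator_const _ hm, smul_eq_mul, mul_one, measureReal_def]
    refine ENNReal.toReal_pos ?_ (measure_ne_top _ _)
    rw [Measure.prod_prod]
    refine mul_ne_zero hpos.ne' ?_
    simp [treatmentLaw, hπ.1]
  filter_upwards [h1.eventually (lt_mem_nhds h2)] with y hy
  by_contra hc
  push Not at hc
  refine hy.ne' ?_
  have : ∀ i, (A ×ˢ {true}).indicator (fun _ => (1 : ℝ)) (x y.1 i y.2) = 0 := fun i =>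
    Set.indicator_of_notMem (fun hi => hc i hi.1 hi.2) _
  simp [avg, this]

/-- Large samples clear at no price outside the box, up to the size of the perturbations. -/
theorem HasPriceBounds.eventually_mem_box (hb : M.HasPriceBounds Θ l u)
    (hπ : 0 < π ∧ π < 1) (hS : IsPerturbedSample μ (Θ.prod (treatmentLaw π)) h x U) :
    ∀ᶠ y : ℕ × Ω in inProbability μ, ∀ p, M.sampleExcess x U y p = 0 →
      ∀ j, l j - h y.1 ≤ p j ∧ p j ≤ u j + h y.1 := by
  have hzero : ∀ {y : ℕ × Ω} {p}, M.sampleExcess x U y p = 0 → 0 < y.1 → ∀ j,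
      ∑ i, M.excess (x y.1 i y.2).1 (x y.1 i y.2).2 (p + WithLp.toLp 2 (U y.1 i y.2)) j = 0 := by
    intro y p hp hy j
    have h1 := congrArg (fun v : Price J => v j) hp
    simp only [sampleExcess_apply, PiLp.zero_apply, avg] at h1
    have hy' : (y.1 : ℝ) ≠ 0 := by exact_mod_cast hy.ne'
    simpa [hy'] using h1
  -- One individual with a strict inequality on each side suffices. If the common price of good `j`
  -- is beyond a bound by more than `h`, every individual price is beyond it, so all terms have one
  -- sign and one of them is nonzero.
  have hA : ∀ᶠ y : ℕ × Ω in inProbability μ, ∀ j,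
      (∃ i, ∀ p : Price J, u j ≤ p j → M.excess (x y.1 i y.2).1 (x y.1 i y.2).2 p j < 0) ∧
        ∃ i, ∀ p : Price J, p j ≤ l j → 0 < M.excess (x y.1 i y.2).1 (x y.1 i y.2).2 p j := by
    refine eventually_all.2 fun j => ?_
    obtain ⟨A, hA, hApos, hAlt⟩ := hb.upper_strict true j
    obtain ⟨B, hB, hBpos, hBlt⟩ := hb.lower_strict true j
    filter_upwards [eventually_exists_treated hπ hS hA hApos,
      eventually_exists_treated hπ hS hB hBpos] with y ⟨i, hi, hw⟩ ⟨i', hi', hw'⟩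
    exact ⟨⟨i, fun p hp => hw ▸ hAlt _ hi p hp⟩, i', fun p hp => hw' ▸ hBlt _ hi' p hp⟩
  filter_upwards [hA, hS.eventually_abs_eq, tendsto_fst_inProbability.eventually_gt_atTop 0]
    with y h1 hU hy p hp j
  obtain ⟨⟨i₁, hi₁⟩, i₂, hi₂⟩ := h1 j
  have hz := hzero hp hy j
  constructor
  · by_contra hc
    push Not at hc
    have hle : ∀ i, (p + WithLp.toLp 2 (U y.1 i y.2)) j ≤ l j := fun i => by
      have := le_abs_self (U y.1 i y.2 j)
      rw [hU i j] at this
      simp only [PiLp.add_apply]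
      linarith
    refine absurd hz (ne_of_gt ?_)
    exact Finset.sum_pos' (fun i _ => hb.lower _ _ j _ (hle i))
      ⟨i₂, Finset.mem_univ _, hi₂ _ (hle i₂)⟩
  · by_contra hc
    push Not at hc
    have hle : ∀ i, u j ≤ (p + WithLp.toLp 2 (U y.1 i y.2)) j := fun i => by
      have := neg_abs_le (U y.1 i y.2 j)
      rw [hU i j] at this
      simp only [PiLp.add_apply]
      linarith
    refine absurd hz (ne_of_lt ?_)
    exact Finset.sum_neg' (fun i _ => hb.upper _ _ j _ (hle i))
      ⟨i₁, Finset.mem_univ _, hi₁ _ (hle i₁)⟩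

end Box

namespace IsNice

variable [MeasurableSpace Ξ] {M : Market Ξ J} {Θ : Measure Ξ} {l u : Price J}
  {Ω : Type*} {x : (n : ℕ) → Fin n → Ω → Ξ × Bool} {U : (n : ℕ) → Fin n → Ω → Fin J → ℝ}
  {O : Set (Price J)} {C : ℝ}

theorem abs_sampleExcess_sub_le (hN : M.IsNice Θ O C) {y : ℕ × Ω} {p q : Price J} (hq : q ∈ O)
    {r : ℝ} (hp : ∀ i, p + WithLp.toLp 2 (U y.1 i y.2) ∈ O)
    (hr : ∀ i, ‖p + WithLp.toLp 2 (U y.1 i y.2) - q‖ ≤ r) (hr0 : 0 ≤ r) (k : Fin J) :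
    |M.sampleExcess x U y p k -
      avg (fun i => M.excess (x y.1 i y.2).1 (x y.1 i y.2).2 q k)| ≤ C * r := by
  have hC := hN.nonneg
  rw [sampleExcess_apply]
  refine abs_avg_sub_avg_le (by positivity) fun i => ?_
  refine ((hN.excess k).abs_sub_le hN.convex (x y.1 i y.2) hq (hp i)).trans ?_
  gcongr
  exact hr i

variable [MeasurableSpace Ω] {μ : Measure Ω} {π : ℝ} {h : ℕ → ℝ}
  [IsProbabilityMeasure Θ] [IsProbabilityMeasure μ]

/-- In large samples, average excess demand plus the identity is a contraction near a price at
which this holds for the mean-field market. -/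
theorem eventually_sampleExcess_contraction (hN : M.IsNice Θ O C) (hπ : 0 < π ∧ π < 1)
    (hS : IsPerturbedSample μ (Θ.prod (treatmentLaw π)) h x U) {p₀ : Price J} (hp₀ : p₀ ∈ O)
    {κ : ℝ} (hκ : κ < 1) (hκ0 : 0 ≤ κ)
    (hc : ‖fderiv ℝ (fun q => M.mixedExcess Θ π q + q) p₀‖ ≤ κ) :
    ∃ r > 0, ∃ κ' < 1, 0 ≤ κ' ∧ ∀ᶠ y : ℕ × Ω in inProbability μ,
      ∀ p ∈ Metric.closedBall p₀ r, ∀ q ∈ Metric.closedBall p₀ r,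
        ‖(M.sampleExcess x U y p + p) - (M.sampleExcess x U y q + q)‖ ≤ κ' * ‖p - q‖ := by
  have : IsProbabilityMeasure (treatmentLaw π) := isProbabilityMeasure_treatmentLaw hπ
  have hC := hN.nonneg
  obtain ⟨r₀, hr₀, hball⟩ := Metric.isOpen_iff.1 hN.isOpen p₀ hp₀
  -- Of the slack `1 - κ`, one quarter pays for the variation of individual gradients on the ball of
  -- radius `2 * r`, which contains all perturbed prices. The choice of `η` below spends another
  -- quarter on sampling error, and `κ + (1 - κ) / 2 = (1 + κ) / 2`.
  obtain ⟨r, hr, hr1, hr2⟩ : ∃ r > 0, 2 * r < r₀ ∧ J * (C * (2 * r)) ≤ (1 - κ) / 4 := by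
    have hden : 0 < 8 * (J * C + 1) := by positivity
    have hk : 0 < (1 - κ) / (8 * (J * C + 1)) := div_pos (by linarith) hden
    refine ⟨min (r₀ / 4) ((1 - κ) / (8 * (J * C + 1))), by positivity, ?_, ?_⟩
    · linarith [min_le_left (r₀ / 4) ((1 - κ) / (8 * (J * C + 1)))]
    · have h1 := min_le_right (r₀ / 4) ((1 - κ) / (8 * (J * C + 1)))
      calc J * (C * (2 * min (r₀ / 4) ((1 - κ) / (8 * (J * C + 1)))))
          = J * C * (2 * min (r₀ / 4) ((1 - κ) / (8 * (J * C + 1)))) := by ring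
        _ ≤ (J * C + 1) * (2 * ((1 - κ) / (8 * (J * C + 1)))) := by gcongr; linarith
        _ = (1 - κ) / 4 := by field_simp; ring
  obtain ⟨η, hη, hη1⟩ : ∃ η > 0, (J : ℝ) * (J * η) ≤ (1 - κ) / 4 := by
    refine ⟨(1 - κ) / (4 * (J * J + 1)), div_pos (by linarith) (by positivity), ?_⟩
    rw [← mul_assoc, mul_div_assoc', div_le_div_iff₀ (by positivity) (by norm_num)]
    nlinarith
  refine ⟨r, hr, (1 + κ) / 2, by linarith, by linarith, ?_⟩
  have hgrad : ∀ᶠ y : ℕ × Ω in inProbability μ, ∀ k m,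
      |avg (fun i => fderiv ℝ (fun q => M.excess (x y.1 i y.2).1 (x y.1 i y.2).2 q k) p₀
        (EuclideanSpace.single m 1)) - fderiv ℝ (M.mixedExcess Θ π) p₀
          (EuclideanSpace.single m 1) k| < η := by
    refine eventually_all.2 fun k => eventually_all.2 fun m => ?_
    have h2 := hS.tendsto_avg_fst ((hN.excess k).measurable_fderiv_apply hp₀
      (EuclideanSpace.single m 1)) (C := C) (fun z => by
        refine ((fderiv ℝ (fun q => M.excess z.1 z.2 q k) p₀).le_of_opNorm_le
          ((hN.excess k).fderiv_bound z p₀ hp₀) _).trans ?_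
        rw [norm_single_one, mul_one])
    rw [← hN.fderiv_mixedExcess_apply hπ hp₀] at h2
    exact h2.eventually (Metric.ball_mem_nhds _ hη)
  have hsmall : ∀ᶠ y : ℕ × Ω in inProbability μ, J * h y.1 < r := by
    have := hS.tendsto_size.const_mul (J : ℝ)
    rw [mul_zero] at this
    exact this.eventually (gt_mem_nhds hr)
  filter_upwards [hgrad, hsmall, hS.eventually_abs_eq] with y hg hhr hU p hp q hq
  have hnear : ∀ p ∈ Metric.closedBall p₀ r, ∀ i, p + WithLp.toLp 2 (U y.1 i y.2) ∈ O ∧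
      ‖p + WithLp.toLp 2 (U y.1 i y.2) - p₀‖ ≤ 2 * r := by
    intro p hp i
    have h1 : ‖p + WithLp.toLp 2 (U y.1 i y.2) - p₀‖ ≤ 2 * r := by
      have h2 := norm_toLp_le_of_abs_eq (hU i)
      have h3 := mem_closedBall_iff_norm.1 hp
      have h4 := norm_add_le (p - p₀) (WithLp.toLp 2 (U y.1 i y.2))
      rw [show p + WithLp.toLp 2 (U y.1 i y.2) - p₀ = p - p₀ + WithLp.toLp 2 (U y.1 i y.2) by abel]
      linarith
    exact ⟨hball (mem_ball_iff_norm.2 (by linarith)), h1⟩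
  have herr : ‖M.sampleExcess x U y p - M.sampleExcess x U y q -
      fderiv ℝ (M.mixedExcess Θ π) p₀ (p - q)‖ ≤ J * ((C * (2 * r) + J * η) * ‖p - q‖) := by
    refine norm_le_of_abs_le fun k => ?_
    set D := fun z : Ξ × Bool => fderiv ℝ (fun q => M.excess z.1 z.2 q k) p₀ with hD
    have h1 : |M.sampleExcess x U y p k - M.sampleExcess x U y q k -
        avg (fun i => D (x y.1 i y.2) (p - q))| ≤ C * (2 * r) * ‖p - q‖ := by
      rw [sampleExcess_apply, sampleExcess_apply, ← avg_sub]
      refine abs_avg_sub_avg_le (by positivity) fun i => ?_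
      have h2 := (hN.excess k).abs_sub_sub_fderiv_le hN.convex (x y.1 i y.2) hp₀
        (hnear q hq i).1 (hnear p hp i).1 (hnear q hq i).2 (hnear p hp i).2 hC
      rwa [add_sub_add_right_eq_sub] at h2
    have h2 : |avg (fun i => D (x y.1 i y.2) (p - q)) -
        fderiv ℝ (M.mixedExcess Θ π) p₀ (p - q) k| ≤ J * η * ‖p - q‖ := by
      have h3 : avg (fun i => D (x y.1 i y.2) (p - q)) =
          ∑ m, avg (fun i => D (x y.1 i y.2) (EuclideanSpace.single m 1)) * (p - q) m := by
        rw [funext fun i => fderiv_apply_eq_sum (D (x y.1 i y.2)) (p - q), avg_sum]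
        refine Finset.sum_congr rfl fun m _ => ?_
        rw [mul_comm, ← avg_const_mul]
        simp only [mul_comm]
      have h4 := fderiv_apply_eq_sum
        ((EuclideanSpace.proj (𝕜 := ℝ) k).comp (fderiv ℝ (M.mixedExcess Θ π) p₀)) (p - q)
      have h4' : fderiv ℝ (M.mixedExcess Θ π) p₀ (p - q) k =
        ∑ m, fderiv ℝ (M.mixedExcess Θ π) p₀ (EuclideanSpace.single m 1) k * (p - q) m := h4
      rw [h3, h4', ← Finset.sum_sub_distrib]
      refine (Finset.abs_sum_le_sum_abs _ _).trans ?_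
      refine (Finset.sum_le_sum (g := fun _ => η * ‖p - q‖) fun m _ => ?_).trans
        (le_of_eq (by simp [mul_assoc]))
      rw [← sub_mul, abs_mul]
      exact mul_le_mul (hg k m).le (abs_apply_le_norm _ m) (abs_nonneg _) hη.le
    rw [PiLp.sub_apply, PiLp.sub_apply, add_mul]
    refine le_trans ?_ (add_le_add h1 h2)
    refine le_trans (le_of_eq ?_) (abs_add_le _ _)
    congr 1
    ring
  have hlin : ‖fderiv ℝ (M.mixedExcess Θ π) p₀ (p - q) + (p - q)‖ ≤ κ * ‖p - q‖ := by
    have hd : HasFDerivAt (fun q => M.mixedExcess Θ π q + q)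
        (fderiv ℝ (M.mixedExcess Θ π) p₀ + ContinuousLinearMap.id ℝ _) p₀ :=
      (hN.differentiableAt_mixedExcess hπ hp₀).hasFDerivAt.add (hasFDerivAt_id p₀)
    rw [hd.fderiv] at hc
    exact ContinuousLinearMap.le_of_opNorm_le _ hc (p - q)
  have hsplit : (M.sampleExcess x U y p + p) - (M.sampleExcess x U y q + q) =
      (fderiv ℝ (M.mixedExcess Θ π) p₀ (p - q) + (p - q)) +
        (M.sampleExcess x U y p - M.sampleExcess x U y q -
          fderiv ℝ (M.mixedExcess Θ π) p₀ (p - q)) := by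
    abel
  rw [hsplit]
  refine (norm_add_le _ _).trans ((add_le_add hlin herr).trans ?_)
  have h5 := norm_nonneg (p - q)
  have h6 : J * ((C * (2 * r) + J * η) * ‖p - q‖) ≤ (1 - κ) / 2 * ‖p - q‖ := by
    rw [← mul_assoc]
    gcongr
    rw [mul_add]
    linarith
  linarith

/-- At a mean-field price, average excess demand is of the order of the perturbations. -/
theorem eventually_norm_sampleExcess_le (hN : M.IsNice Θ O C) (hπ : 0 < π ∧ π < 1)
    (hS : IsPerturbedSample μ (Θ.prod (treatmentLaw π)) h x U) {p₀ : Price J} (hp₀ : p₀ ∈ O)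
    (hz : M.mixedExcess Θ π p₀ = 0) :
    ∀ᶠ y : ℕ × Ω in inProbability μ,
      ‖M.sampleExcess x U y p₀‖ ≤ J * (C * J + 1) * h y.1 := by
  have : IsProbabilityMeasure (treatmentLaw π) := isProbabilityMeasure_treatmentLaw hπ
  have hC := hN.nonneg
  obtain ⟨r₀, hr₀, hball⟩ := Metric.isOpen_iff.1 hN.isOpen p₀ hp₀
  -- The sampling error is `o(h)`, hence eventually below `h`: this is the `+ 1` in the constant.
  -- The summand `C * J` is the shift caused by the perturbations.
  have hlln : ∀ᶠ y : ℕ × Ω in inProbability μ, ∀ k,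
      |avg (fun i => M.excess (x y.1 i y.2).1 (x y.1 i y.2).2 p₀ k) / h y.1| < 1 := by
    refine eventually_all.2 fun k => ?_
    have h2 := hS.tendsto_avg_fst_div ((hN.excess k).measurable p₀)
      (fun z => (hN.excess k).bound z p₀ hp₀)
    rw [← hN.mixedExcess_apply hπ hp₀, hz] at h2
    have h3 := h2.eventually (Metric.ball_mem_nhds _ one_pos)
    filter_upwards [h3] with y hy
    simpa only [PiLp.zero_apply, sub_zero, Metric.mem_ball, dist_zero_right, Real.norm_eq_abs]
      using hy
  have hsmall : ∀ᶠ y : ℕ × Ω in inProbability μ, J * h y.1 < r₀ := by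
    have := hS.tendsto_size.const_mul (J : ℝ)
    rw [mul_zero] at this
    exact this.eventually (gt_mem_nhds hr₀)
  filter_upwards [hlln, hsmall, hS.eventually_abs_eq, hS.eventually_pos] with y h1 h2 hU hpos
  have hn : ∀ i, ‖p₀ + WithLp.toLp 2 (U y.1 i y.2) - p₀‖ ≤ J * h y.1 := fun i => by
    rw [add_sub_cancel_left]
    exact norm_toLp_le_of_abs_eq (hU i)
  rw [mul_assoc]
  refine norm_le_of_abs_le fun k => ?_
  have h3 := hN.abs_sampleExcess_sub_le (x := x) hp₀
    (fun i => hball (mem_ball_iff_norm.2 ((hn i).trans_lt h2))) hn (by positivity) k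
  have h4 := h1 k
  rw [abs_div, abs_of_pos hpos, div_lt_one hpos] at h4
  have h5 := abs_sub_abs_le_abs_sub (M.sampleExcess x U y p₀ k)
    (avg (fun i => M.excess (x y.1 i y.2).1 (x y.1 i y.2).2 p₀ k))
  linarith

/-- The market price is within the order of the perturbations of the mean-field price. -/
theorem eventually_norm_marketPrice_sub_le {δ : ℝ} (hδ : 0 < δ)
    (hN : M.IsNice Θ (Metric.thickening δ (priceBox l u)) C) (hb : M.HasPriceBounds Θ l u)
    (hπ : 0 < π ∧ π < 1) (hS : IsPerturbedSample μ (Θ.prod (treatmentLaw π)) h x U)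
    {p₀ : Price J} (hp₀ : M.IsMeanFieldPrice Θ l u π p₀)
    (hc : ∀ p ∈ priceBox l u, ‖fderiv ℝ (fun q => M.mixedExcess Θ π q + q) p‖ < 1)
    {P : ℕ × Ω → Price J} (hP : ∀ᶠ y : ℕ × Ω in inProbability μ, ∀ q,
      ‖M.sampleExcess x U y (P y)‖ ≤ ‖M.sampleExcess x U y q‖) :
    ∃ K, ∀ᶠ y : ℕ × Ω in inProbability μ, ‖P y - p₀‖ ≤ K * h y.1 := by
  have : IsProbabilityMeasure (treatmentLaw π) := isProbabilityMeasure_treatmentLaw hπ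
  have hC := hN.nonneg
  have hO : priceBox l u ⊆ Metric.thickening δ (priceBox l u) :=
    Metric.self_subset_thickening hδ _
  obtain ⟨κ, hκ, hκ0, hcκ, hκlip⟩ := hN.exists_contraction hπ hO ⟨p₀, hp₀.1⟩ hc
  obtain ⟨r, hr, κ', hκ', hκ'0, hcontr⟩ :=
    hN.eventually_sampleExcess_contraction hπ hS (hO hp₀.1) hκ hκ0 (hcκ p₀ hp₀.1)
  have hK := hN.eventually_norm_sampleExcess_le hπ hS (hO hp₀.1) hp₀.2
  set K := J * (C * J + 1) with hKdef
  have hscale : ∀ (c ε : ℝ), 0 < ε → ∀ᶠ y : ℕ × Ω in inProbability μ, c * h y.1 < ε := by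
    intro c ε hε
    have := hS.tendsto_size.const_mul c
    rw [mul_zero] at this
    exact this.eventually (gt_mem_nhds hε)
  have hp₀r : p₀ ∈ Metric.closedBall p₀ r := Metric.mem_closedBall_self hr.le
  -- The ball is preserved since `κ' * r + K * h ≤ r` for small `h`. A fixed point of `sampleExcess
  -- + id` is an exact zero, so the minimal norm is zero and is attained at `P y` as well.
  have hclear : ∀ᶠ y : ℕ × Ω in inProbability μ, M.sampleExcess x U y (P y) = 0 := by
    filter_upwards [hcontr, hK, hscale K ((1 - κ') * r) (mul_pos (by linarith) hr), hP]
      with y h1 h2 h3 h4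
    have hT : Set.MapsTo (fun p => M.sampleExcess x U y p + p) (Metric.closedBall p₀ r)
        (Metric.closedBall p₀ r) := by
      intro p hp
      rw [mem_closedBall_iff_norm] at hp ⊢
      have h5 := h1 p (mem_closedBall_iff_norm.2 hp) p₀ hp₀r
      have h6 := norm_add_le ((M.sampleExcess x U y p + p) - (M.sampleExcess x U y p₀ + p₀))
        (M.sampleExcess x U y p₀)
      rw [show (M.sampleExcess x U y p + p) - (M.sampleExcess x U y p₀ + p₀) +
        M.sampleExcess x U y p₀ = M.sampleExcess x U y p + p - p₀ by abel] at h6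
      have h7 : κ' * ‖p - p₀‖ ≤ κ' * r := by gcongr
      linarith
    obtain ⟨q, -, hq⟩ := exists_fixedPoint_of_contraction Metric.isClosed_closedBall
      ⟨p₀, hp₀r⟩ hT hκ' h1
    have h5 := h4 q
    rw [show M.sampleExcess x U y q = 0 by simpa using hq, norm_zero] at h5
    exact norm_le_zero_iff.1 h5
  have hlln : ∀ᶠ y : ℕ × Ω in inProbability μ, ∀ p ∈ priceBox l u, ∀ k,
      |avg (fun i => M.excess (x y.1 i y.2).1 (x y.1 i y.2).2 p k) - M.mixedExcess Θ π p k| ≤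
        (1 - κ) * r / (4 * (J + 1)) := by
    have h1 : ∀ᶠ y : ℕ × Ω in inProbability μ, ∀ k, ∀ p ∈ priceBox l u,
        |avg (fun i => M.excess (x y.1 i y.2).1 (x y.1 i y.2).2 p k) -
          ∫ z, M.excess z.1 z.2 p k ∂(Θ.prod (treatmentLaw π))| ≤
            (1 - κ) * r / (4 * (J + 1)) :=
      eventually_all.2 fun k => hS.eventually_abs_avg_sub_integral_le (hN.excess k) hN.convex
        hN.isOpen hC (isCompact_priceBox l u) hO
        (div_pos (mul_pos (by linarith) hr) (by positivity))
    filter_upwards [h1] with y hy p hp k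
    rw [hN.mixedExcess_apply hπ (hO hp)]
    exact hy k p hp
  refine ⟨(1 - κ')⁻¹ * K, ?_⟩
  filter_upwards [hclear, hlln, hcontr, hK, HasPriceBounds.eventually_mem_box hb hπ hS,
    hS.eventually_pos, hS.eventually_abs_eq, hscale (2 * J) δ hδ, hscale J (r / 2) (half_pos hr),
    hscale (J * (C * (2 * J))) ((1 - κ) * r / 4) (by nlinarith)]
    with y hz hl hct hKy hbox hpos hU hs1 hs2 hs3
  have hlu := fun j => (hb.lower_lt_upper j).le
  -- The mean-field contraction is known only on the box, which `P y` may miss by the size of the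
  -- perturbations; `q` is its representative in the box.
  set q := boxClamp l u (P y) with hq
  have hqm : q ∈ priceBox l u := boxClamp_mem hlu _
  have hPq : ‖P y - q‖ ≤ J * h y.1 := norm_sub_boxClamp_le hlu hpos.le (hbox _ hz)
  have hPU : ∀ i, ‖P y + WithLp.toLp 2 (U y.1 i y.2) - q‖ ≤ 2 * J * h y.1 := fun i => by
    have h2 := norm_toLp_le_of_abs_eq (hU i)
    have h4 := norm_add_le (P y - q) (WithLp.toLp 2 (U y.1 i y.2))
    rw [show P y + WithLp.toLp 2 (U y.1 i y.2) - q = P y - q + WithLp.toLp 2 (U y.1 i y.2) by abel]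
    linarith
  -- Half of the allowance comes from replacing perturbed prices by `q`, half from the uniform law
  -- of large numbers on the box; `J + 1` in the tolerance absorbs the sum over goods.
  have hzq : ‖M.mixedExcess Θ π q‖ ≤ (1 - κ) * r / 2 := by
    have h1 : ‖M.mixedExcess Θ π q‖ ≤
        J * (C * (2 * J * h y.1) + (1 - κ) * r / (4 * (J + 1))) := by
      refine norm_le_of_abs_le fun k => ?_
      have h2 := hN.abs_sampleExcess_sub_le (x := x) (hO hqm) (fun i =>
        Metric.mem_thickening_iff.2 ⟨q, hqm, by
          rw [dist_eq_norm]; exact (hPU i).trans_lt hs1⟩) hPU (by positivity) k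
      have h3 := hl q hqm k
      rw [hz, PiLp.zero_apply] at h2
      rw [abs_le] at *
      constructor <;> linarith [h2.1, h2.2, h3.1, h3.2]
    refine h1.trans ?_
    have h2 : J * ((1 - κ) * r / (4 * (J + 1))) ≤ (1 - κ) * r / 4 := by
      rw [mul_div_assoc', div_le_div_iff₀ (by positivity) (by norm_num)]
      nlinarith [mul_pos (sub_pos.2 hκ) hr]
    rw [mul_add]
    have h3 : J * (C * (2 * J * h y.1)) = J * (C * (2 * J)) * h y.1 := by ring
    rw [h3]
    linarith
  have hqp : ‖q - p₀‖ ≤ r / 2 := by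
    have h1 := (norm_sub_le_of_contraction (hκlip q hqm p₀ hp₀.1) hp₀.2).trans hzq
    rw [mul_div_assoc] at h1
    exact le_of_mul_le_mul_left h1 (by linarith)
  have hPm : P y ∈ Metric.closedBall p₀ r := by
    rw [mem_closedBall_iff_norm]
    have := norm_sub_le_norm_sub_add_norm_sub (P y) q p₀
    linarith
  -- Now that `P y` is in the ball, the sample contraction with zero `P y` is compared at `p₀`,
  -- where the residual is at most `K * h`. This improves a fixed radius to the rate `h`.
  have h1 := norm_sub_le_of_contraction (hct p₀ hp₀r (P y) hPm) hz
  rw [norm_sub_rev, ← le_div_iff₀' (by linarith), div_eq_inv_mul] at h1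
  refine h1.trans ?_
  rw [mul_assoc]
  have : 0 < (1 - κ')⁻¹ := inv_pos.2 (by linarith)
  gcongr

end IsNice
end Market

/-! ### Regressions on the perturbations -/

namespace IsPerturbedSample

variable {Ω X : Type*} [MeasurableSpace Ω] [MeasurableSpace X] {J : ℕ} {μ : Measure Ω}
  {ρ : Measure X} {h : ℕ → ℝ} {x : (n : ℕ) → Fin n → Ω → X}
  {U : (n : ℕ) → Fin n → Ω → Fin J → ℝ} {f : X → Price J → ℝ} {O : Set (Price J)} {C K : ℝ}
  {P : ℕ × Ω → Price J} {p₀ : Price J}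

/-- Individual prices are within the order of the perturbations of the limiting price. -/
theorem eventually_price_mem (hS : IsPerturbedSample μ ρ h x U) (hOo : IsOpen O) (hp₀ : p₀ ∈ O)
    (hP : ∀ᶠ y : ℕ × Ω in inProbability μ, ‖P y - p₀‖ ≤ K * h y.1) :
    ∀ᶠ y : ℕ × Ω in inProbability μ, ∀ i, P y + WithLp.toLp 2 (U y.1 i y.2) ∈ O ∧
      ‖P y + WithLp.toLp 2 (U y.1 i y.2) - p₀‖ ≤ (K + J) * h y.1 := by
  obtain ⟨r₀, hr₀, hball⟩ := Metric.isOpen_iff.1 hOo p₀ hp₀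
  have hsmall : ∀ᶠ y : ℕ × Ω in inProbability μ, (K + J) * h y.1 < r₀ := by
    have := hS.tendsto_size.const_mul (K + J)
    rw [mul_zero] at this
    exact this.eventually (gt_mem_nhds hr₀)
  filter_upwards [hP, hsmall, hS.eventually_abs_eq] with y h1 h2 hU i
  have h3 : ‖P y + WithLp.toLp 2 (U y.1 i y.2) - p₀‖ ≤ (K + J) * h y.1 := by
    have h4 := norm_toLp_le_of_abs_eq (hU i)
    have h5 := norm_add_le (P y - p₀) (WithLp.toLp 2 (U y.1 i y.2))
    rw [show P y + WithLp.toLp 2 (U y.1 i y.2) - p₀ = P y - p₀ + WithLp.toLp 2 (U y.1 i y.2) by abel]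
    linarith
  exact ⟨hball (mem_ball_iff_norm.2 (by linarith)), h3⟩

theorem eventually_abs_sub_le (hS : IsPerturbedSample μ ρ h x U)
    (hf : IsUniformlyC11 f O C) (hO : Convex ℝ O) (hOo : IsOpen O) (hC : 0 ≤ C) (hp₀ : p₀ ∈ O)
    (hP : ∀ᶠ y : ℕ × Ω in inProbability μ, ‖P y - p₀‖ ≤ K * h y.1) :
    ∀ᶠ y : ℕ × Ω in inProbability μ, ∀ i,
      |f (x y.1 i y.2) (P y + WithLp.toLp 2 (U y.1 i y.2)) - f (x y.1 i y.2) p₀| ≤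
        C * (K + J) * h y.1 := by
  filter_upwards [hS.eventually_price_mem hOo hp₀ hP] with y hy i
  refine (hf.abs_sub_le hO _ hp₀ (hy i).1).trans ?_
  rw [mul_assoc]
  gcongr
  exact (hy i).2

variable [IsProbabilityMeasure μ] [IsProbabilityMeasure ρ]

/-- The covariance of perturbations and responses at the perturbed price identifies the mean
derivative of the responses. -/
theorem tendsto_avg_perturbation_mul (hS : IsPerturbedSample μ ρ h x U)
    (hf : IsUniformlyC11 f O C) (hO : Convex ℝ O) (hOo : IsOpen O) (hC : 0 ≤ C) (hp₀ : p₀ ∈ O)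
    (hP : ∀ᶠ y : ℕ × Ω in inProbability μ, ‖P y - p₀‖ ≤ K * h y.1) (j : Fin J) :
    Tendsto (fun y : ℕ × Ω => avg (fun i => U y.1 i y.2 j *
        f (x y.1 i y.2) (P y + WithLp.toLp 2 (U y.1 i y.2))) / h y.1 ^ 2)
      (inProbability μ) (𝓝 (∫ z, fderiv ℝ (f z) p₀ (EuclideanSpace.single j 1) ∂ρ)) := by
  set g : Fin J → X → ℝ := fun m z => fderiv ℝ (f z) p₀ (EuclideanSpace.single m 1) with hg
  have hgm : ∀ m, Measurable (g m) := fun m => hf.measurable_fderiv_apply hp₀ _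
  have hgC : ∀ m z, |g m z| ≤ C := fun m z => by
    refine ((fderiv ℝ (f z) p₀).le_of_opNorm_le (hf.fderiv_bound z p₀ hp₀) _).trans ?_
    rw [norm_single_one, mul_one]
  have hd : ∀ m, Tendsto (fun y => (P y - p₀) m) (inProbability μ) (𝓝 0) := fun m => by
    have h1 := hS.tendsto_size.const_mul K
    rw [mul_zero] at h1
    refine squeeze_zero_norm' ?_ h1
    filter_upwards [hP] with y hy
    exact (abs_apply_le_norm _ m).trans hy
  -- Expansion at `p₀`. The price enters only through factors `(P y - p₀) m` outside the averages,
  -- so its dependence on the perturbations does no harm; of the quadratic terms only `m = j`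
  -- survives.
  have hmain : Tendsto (fun y : ℕ × Ω =>
      avg (fun i => f (x y.1 i y.2) p₀ * U y.1 i y.2 j) / h y.1 ^ 2 +
        ∑ m, ((P y - p₀) m * (avg (fun i => g m (x y.1 i y.2) * U y.1 i y.2 j) / h y.1 ^ 2) +
          avg (fun i => g m (x y.1 i y.2) * (U y.1 i y.2 j * U y.1 i y.2 m)) / h y.1 ^ 2))
      (inProbability μ) (𝓝 (∫ z, g j z ∂ρ)) := by
    have h1 := hS.tendsto_avg_sign_div (hf.measurable p₀) (fun z => hf.bound z p₀ hp₀) j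
    have h2 := tendsto_finsetSum (Finset.univ : Finset (Fin J)) fun m _ =>
      ((hd m).mul (hS.tendsto_avg_sign_div (hgm m) (hgC m) j)).add
        (hS.tendsto_avg_sign_mul_sign (hgm m) (hgC m) j m)
    have h3 := h1.add h2
    simpa using h3
  have hrem : Tendsto (fun y : ℕ × Ω => C * (K + J) ^ 2 * h y.1) (inProbability μ) (𝓝 0) := by
    simpa using hS.tendsto_size.const_mul (C * (K + J) ^ 2)
  refine hmain.congr_dist (squeeze_zero' (Eventually.of_forall fun _ => dist_nonneg) ?_ hrem)
  filter_upwards [hS.eventually_price_mem hOo hp₀ hP, hS.eventually_abs_eq, hS.eventually_pos]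
    with y hy hU hpos
  have hsum : avg (fun i => f (x y.1 i y.2) p₀ * U y.1 i y.2 j) / h y.1 ^ 2 +
        ∑ m, ((P y - p₀) m * (avg (fun i => g m (x y.1 i y.2) * U y.1 i y.2 j) / h y.1 ^ 2) +
          avg (fun i => g m (x y.1 i y.2) * (U y.1 i y.2 j * U y.1 i y.2 m)) / h y.1 ^ 2) =
      avg (fun i => U y.1 i y.2 j * (f (x y.1 i y.2) p₀ +
        fderiv ℝ (f (x y.1 i y.2)) p₀ (P y + WithLp.toLp 2 (U y.1 i y.2) - p₀))) / h y.1 ^ 2 := by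
    have h1 : ∀ i, U y.1 i y.2 j * (f (x y.1 i y.2) p₀ +
        fderiv ℝ (f (x y.1 i y.2)) p₀ (P y + WithLp.toLp 2 (U y.1 i y.2) - p₀)) =
        f (x y.1 i y.2) p₀ * U y.1 i y.2 j +
          ∑ m, ((P y - p₀) m * (g m (x y.1 i y.2) * U y.1 i y.2 j) +
            g m (x y.1 i y.2) * (U y.1 i y.2 j * U y.1 i y.2 m)) := by
      intro i
      rw [fderiv_apply_eq_sum, mul_add, Finset.mul_sum, mul_comm (U y.1 i y.2 j)]
      congr 1
      refine Finset.sum_congr rfl fun m _ => ?_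
      simp only [hg, PiLp.sub_apply, PiLp.add_apply]
      ring
    simp only [h1]
    rw [avg_add, avg_sum, add_div, Finset.sum_div]
    congr 1
    refine Finset.sum_congr rfl fun m _ => ?_
    rw [avg_add, avg_const_mul]
    ring
  rw [hsum, Real.dist_eq, ← sub_div, abs_div, abs_of_pos (pow_pos hpos 2),
    div_le_iff₀ (pow_pos hpos 2), abs_sub_comm]
  have hKJ : ∀ i, ‖P y + WithLp.toLp 2 (U y.1 i y.2) - p₀‖ ^ 2 ≤ ((K + J) * h y.1) ^ 2 := fun i =>
    pow_le_pow_left₀ (norm_nonneg _) (hy i).2 2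
  -- Taylor remainder: one factor `h` from `U` and `((K + J) * h) ^ 2` from the displacement, so
  -- `O(h)` remains after division by `h ^ 2`.
  refine abs_avg_sub_avg_le (by positivity) fun i => ?_
  rw [← mul_sub, abs_mul, hU i j, ← sub_sub]
  calc h y.1 * |f (x y.1 i y.2) (P y + WithLp.toLp 2 (U y.1 i y.2)) - f (x y.1 i y.2) p₀ -
        fderiv ℝ (f (x y.1 i y.2)) p₀ (P y + WithLp.toLp 2 (U y.1 i y.2) - p₀)|
      ≤ h y.1 * (C * ((K + J) * h y.1) ^ 2) := by
        gcongr
        refine (hf.abs_taylor_le hO _ hp₀ (hy i).1 hC).trans ?_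
        exact mul_le_mul_of_nonneg_left (hKJ i) hC
    _ = C * (K + J) ^ 2 * h y.1 * h y.1 ^ 2 := by ring

/-- Weighted averages at the perturbed price converge to the mean at the limiting price. -/
theorem tendsto_avg_mul_perturbed (hS : IsPerturbedSample μ ρ h x U)
    (hf : IsUniformlyC11 f O C) (hO : Convex ℝ O) (hOo : IsOpen O) (hC : 0 ≤ C) (hp₀ : p₀ ∈ O)
    (hP : ∀ᶠ y : ℕ × Ω in inProbability μ, ‖P y - p₀‖ ≤ K * h y.1) {φ : X → ℝ}
    (hφ : Measurable φ) {B : ℝ} (hB : ∀ z, |φ z| ≤ B) (hB0 : 0 ≤ B) :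
    Tendsto (fun y : ℕ × Ω => avg (fun i => φ (x y.1 i y.2) *
        f (x y.1 i y.2) (P y + WithLp.toLp 2 (U y.1 i y.2))))
      (inProbability μ) (𝓝 (∫ z, φ z * f z p₀ ∂ρ)) := by
  have h1 := hS.tendsto_avg_fst (hφ.mul (hf.measurable p₀)) (C := B * C) fun z => by
    rw [Pi.mul_apply, abs_mul]
    gcongr
    · exact hB z
    · exact hf.bound z p₀ hp₀
  have hrem : Tendsto (fun y : ℕ × Ω => B * (C * (K + J) * h y.1)) (inProbability μ) (𝓝 0) := by
    simpa using (hS.tendsto_size.const_mul (C * (K + J))).const_mul B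
  refine h1.congr_dist (squeeze_zero' (Eventually.of_forall fun _ => dist_nonneg) ?_ hrem)
  filter_upwards [hS.eventually_abs_sub_le hf hO hOo hC hp₀ hP,
    tendsto_fst_inProbability.eventually_gt_atTop 0] with y hy h0
  rw [Real.dist_eq, abs_sub_comm]
  -- `K` has no assumed sign, so nonnegativity of the bound is read off from individual `0`, who
  -- exists because `n > 0`.
  refine abs_avg_sub_avg_le (mul_nonneg hB0 ((abs_nonneg _).trans (hy ⟨0, h0⟩))) fun i => ?_
  rw [Pi.mul_apply, ← mul_sub, abs_mul]
  gcongr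
  · exact hB _
  · exact hy i

/-- The Gram matrix of the perturbations, normalized, converges to the identity. -/
theorem tendsto_gram (hS : IsPerturbedSample μ ρ h x U) :
    Tendsto (fun y : ℕ × Ω => ((y.1 : ℝ) * h y.1 ^ 2)⁻¹ •
        ((Matrix.of fun i => U y.1 i y.2)ᵀ * (Matrix.of fun i => U y.1 i y.2)))
      (inProbability μ) (𝓝 (1 : Matrix (Fin J) (Fin J) ℝ)) := by
  refine tendsto_pi_nhds.2 fun j => tendsto_pi_nhds.2 fun m => ?_
  have h1 := hS.tendsto_avg_sign_mul_sign (f := fun _ => 1) measurable_const (C := 1)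
    (fun _ => by simp) j m
  have h2 : (if j = m then ∫ _, (1 : ℝ) ∂ρ else 0) = (1 : Matrix (Fin J) (Fin J) ℝ) j m := by
    simp [Matrix.one_apply]
  rw [h2] at h1
  refine h1.congr fun y => ?_
  simp only [avg, one_mul, Matrix.smul_apply, Matrix.mul_apply, Matrix.transpose_apply,
    Matrix.of_apply, smul_eq_mul, mul_inv]
  ring

end IsPerturbedSample

/-! ### Continuity of the estimators -/

theorem tendsto_matrix_inv {ι : Type*} {F : Filter ι} {J : ℕ} {A : ι → Matrix (Fin J) (Fin J) ℝ}
    {A₀ : Matrix (Fin J) (Fin J) ℝ} (hA : Tendsto A F (𝓝 A₀)) (h₀ : IsUnit A₀) :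
    Tendsto (fun y => (A y)⁻¹) F (𝓝 A₀⁻¹) := by
  have hdet : A₀.det ≠ 0 := ((Matrix.isUnit_iff_isUnit_det _).1 h₀).ne_zero
  refine (continuousAt_matrix_inv A₀ ?_).tendsto.comp hA
  rw [Ring.inverse_eq_inv']
  exact continuousAt_inv₀ hdet

theorem tendsto_mulVec {ι : Type*} {F : Filter ι} {J : ℕ} {A : ι → Matrix (Fin J) (Fin J) ℝ}
    {A₀ : Matrix (Fin J) (Fin J) ℝ} (hA : Tendsto A F (𝓝 A₀)) {v : ι → Fin J → ℝ} {v₀ : Fin J → ℝ}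
    (hv : Tendsto v F (𝓝 v₀)) : Tendsto (fun y => A y *ᵥ v y) F (𝓝 (A₀ *ᵥ v₀)) := by
  have hc : Continuous fun z : Matrix (Fin J) (Fin J) ℝ × (Fin J → ℝ) => z.1 *ᵥ z.2 :=
    continuous_fst.matrix_mulVec continuous_snd
  exact (hc.tendsto (A₀, v₀)).comp (hA.prodMk_nhds hv)

theorem inv_smul_eq_of_isUnit {J : ℕ} {A : Matrix (Fin J) (Fin J) ℝ} {s : ℝ} (hs : s ≠ 0)
    (hA : IsUnit (s • A).det) : A⁻¹ = s • (s • A)⁻¹ := by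
  have h1 : A = s⁻¹ • (s • A) := by rw [smul_smul, inv_mul_cancel₀ hs, one_smul]
  conv_lhs => rw [h1]
  refine Matrix.inv_eq_right_inv ?_
  rw [smul_mul_smul_comm, inv_mul_cancel₀ hs, one_smul, Matrix.mul_nonsing_inv _ hA]

theorem eventually_det_ne_zero {ι : Type*} {F : Filter ι} {J : ℕ}
    {A : ι → Matrix (Fin J) (Fin J) ℝ} (hA : Tendsto A F (𝓝 1)) : ∀ᶠ y in F, (A y).det ≠ 0 := by
  have hc : Continuous fun A : Matrix (Fin J) (Fin J) ℝ => A.det := continuous_id.matrix_det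
  have h1 : Tendsto (fun y => (A y).det) F (𝓝 (1 : Matrix (Fin J) (Fin J) ℝ).det) :=
    (hc.tendsto 1).comp hA
  exact h1.eventually_ne (by simp)

/-- Least squares on regressors whose normalized Gram matrix converges to the identity. -/
theorem tendsto_gram_inv_mul {ι : Type*} {F : Filter ι} {J : ℕ}
    {S B : ι → Matrix (Fin J) (Fin J) ℝ} {s : ι → ℝ} (hs : ∀ᶠ y in F, s y ≠ 0)
    (hS : Tendsto (fun y => s y • S y) F (𝓝 1)) {B₀ : Matrix (Fin J) (Fin J) ℝ}
    (hB : Tendsto (fun y => s y • B y) F (𝓝 B₀)) :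
    Tendsto (fun y => (S y)⁻¹ * B y) F (𝓝 B₀) := by
  have hinv := tendsto_matrix_inv hS isUnit_one
  rw [inv_one] at hinv
  have h1 := hinv.mul hB
  rw [one_mul] at h1
  refine h1.congr' ?_
  filter_upwards [hs, eventually_det_ne_zero hS] with y h2 h3
  rw [inv_smul_eq_of_isUnit h2 (isUnit_iff_ne_zero.2 h3), Matrix.mul_smul, Matrix.smul_mul]

theorem tendsto_gram_inv_mulVec {ι : Type*} {F : Filter ι} {J : ℕ}
    {S : ι → Matrix (Fin J) (Fin J) ℝ} {v : ι → Fin J → ℝ} {s : ι → ℝ} (hs : ∀ᶠ y in F, s y ≠ 0)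
    (hS : Tendsto (fun y => s y • S y) F (𝓝 1)) {v₀ : Fin J → ℝ}
    (hv : Tendsto (fun y => s y • v y) F (𝓝 v₀)) :
    Tendsto (fun y => (S y)⁻¹ *ᵥ v y) F (𝓝 v₀) := by
  have hinv := tendsto_matrix_inv hS isUnit_one
  rw [inv_one] at hinv
  have h1 := tendsto_mulVec hinv hv
  rw [Matrix.one_mulVec] at h1
  refine h1.congr' ?_
  filter_upwards [hs, eventually_det_ne_zero hS] with y h2 h3
  rw [inv_smul_eq_of_isUnit h2 (isUnit_iff_ne_zero.2 h3), Matrix.mulVec_smul, Matrix.smul_mulVec]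

/-- Averages of squares are insensitive to uniformly small changes. -/
theorem abs_avg_sq_sub_avg_sq_le {n : ℕ} {a b : Fin n → ℝ} {d R : ℝ} (hd : 0 ≤ d) (hR : 0 ≤ R)
    (hab : ∀ i, |a i - b i| ≤ d) (hb : ∀ i, |b i| ≤ R) :
    |avg (fun i => a i ^ 2) - avg (fun i => b i ^ 2)| ≤ d * (d + 2 * R) := by
  refine abs_avg_sub_avg_le (by positivity) fun i => ?_
  have h1 : a i ^ 2 - b i ^ 2 = (a i - b i) * ((a i - b i) + 2 * b i) := by ring
  rw [h1, abs_mul]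
  have h2 : |(a i - b i) + 2 * b i| ≤ d + 2 * R := by
    refine (abs_add_le _ _).trans ?_
    rw [abs_mul, abs_two]
    linarith [hab i, hb i]
  exact mul_le_mul (hab i) h2 (abs_nonneg _) hd

/-- The weight of an individual with treatment `w` in the Horvitz-Thompson estimator. -/
noncomputable def horvitzThompsonWeight (π : ℝ) (w : Bool) : ℝ := if w then π⁻¹ else -(1 - π)⁻¹

theorem tauZ_eq_avg {n J : ℕ} (π : ℝ) (W : Fin n → Bool) (Z : Matrix (Fin n) (Fin J) ℝ)
    (j : Fin J) :
    Estimator.tauZ π W Z j = avg fun i => horvitzThompsonWeight π (W i) * Z i j := by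
  rw [Estimator.tauZ, avg]
  congr 1
  refine Finset.sum_congr rfl fun i _ => ?_
  rw [horvitzThompsonWeight]
  split_ifs <;> simp [div_eq_inv_mul]

theorem abs_horvitzThompsonWeight_le {π : ℝ} (hπ : 0 < π ∧ π < 1) (w : Bool) :
    |horvitzThompsonWeight π w| ≤ π⁻¹ + (1 - π)⁻¹ := by
  have h1 : 0 < π⁻¹ := inv_pos.2 hπ.1
  have h2 : 0 < (1 - π)⁻¹ := inv_pos.2 (sub_pos.2 hπ.2)
  rw [horvitzThompsonWeight]
  split_ifs
  · rw [abs_of_pos h1]; linarith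
  · rw [abs_neg, abs_of_pos h2]; linarith

/-! ### Consistency of the estimators. -/

namespace Market

variable {Ξ : Type*} {J : ℕ} [MeasurableSpace Ξ] {M : Market Ξ J} {Θ : Measure Ξ} {l u : Price J}
  {Ω : Type*} [MeasurableSpace Ω] {μ : Measure Ω} {π : ℝ} {h : ℕ → ℝ}
  {x : (n : ℕ) → Fin n → Ω → Ξ × Bool} {U : (n : ℕ) → Fin n → Ω → Fin J → ℝ}
  {O : Set (Price J)} {C K : ℝ} {P : ℕ × Ω → Price J} {p₀ : Price J}

/-- Observed treatments in a sample. -/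
def sampleTreatment (x : (n : ℕ) → Fin n → Ω → Ξ × Bool) (y : ℕ × Ω) : Fin y.1 → Bool :=
  fun i => (x y.1 i y.2).2

/-- Perturbations in a sample. -/
def samplePerturbation (U : (n : ℕ) → Fin n → Ω → Fin J → ℝ) (y : ℕ × Ω) :
    Matrix (Fin y.1) (Fin J) ℝ :=
  Matrix.of fun i => U y.1 i y.2

/-- Observed excess demands in a sample. -/
def sampleObservedExcess (M : Market Ξ J) (x : (n : ℕ) → Fin n → Ω → Ξ × Bool)
    (U : (n : ℕ) → Fin n → Ω → Fin J → ℝ) (P : ℕ × Ω → Price J) (y : ℕ × Ω) :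
    Matrix (Fin y.1) (Fin J) ℝ :=
  M.observedExcess (fun i => (x y.1 i y.2).1) (fun i => (x y.1 i y.2).2) (fun i => U y.1 i y.2) (P y)

/-- Observed outcomes in a sample. -/
def sampleObservedOutcome (M : Market Ξ J) (x : (n : ℕ) → Fin n → Ω → Ξ × Bool)
    (U : (n : ℕ) → Fin n → Ω → Fin J → ℝ) (P : ℕ × Ω → Price J) (y : ℕ × Ω) : Fin y.1 → ℝ :=
  M.observedOutcome (fun i => (x y.1 i y.2).1) (fun i => (x y.1 i y.2).2) (fun i => U y.1 i y.2)
    (P y)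

namespace IsNice

variable [IsProbabilityMeasure Θ]

/-- Inverse-probability weighting: the weights `π⁻¹` and `-(1 - π)⁻¹` cancel the treatment
probabilities and leave treated minus untreated means. -/
theorem integral_weight_mul_excess (hN : M.IsNice Θ O C) (hπ : 0 < π ∧ π < 1) (hp₀ : p₀ ∈ O)
    (k : Fin J) :
    ∫ z, horvitzThompsonWeight π z.2 * M.excess z.1 z.2 p₀ k ∂(Θ.prod (treatmentLaw π)) =
      M.excessEffect Θ p₀ k := by
  have : IsProbabilityMeasure (treatmentLaw π) := isProbabilityMeasure_treatmentLaw hπ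
  have hw : Measurable fun z : Ξ × Bool => horvitzThompsonWeight π z.2 :=
    (measurable_of_finite (horvitzThompsonWeight π)).comp measurable_snd
  have hi := fun w => (hN.excess_treatment w k).integrable Θ hp₀
  rw [integral_prod_treatmentLaw Θ hπ
    (((hN.excess k).integrable _ hp₀).bdd_mul hw.aestronglyMeasurable
      (Eventually.of_forall fun z => abs_horvitzThompsonWeight_le hπ z.2))
    fun w => (hi w).const_mul (horvitzThompsonWeight π w)]
  simp only [integral_const_mul, horvitzThompsonWeight, if_true, Bool.false_eq_true, if_false]
  rw [excessEffect, PiLp.sub_apply, hN.meanExcess_apply hp₀, hN.meanExcess_apply hp₀]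
  have h1 := hπ.1.ne'
  have h2 := (sub_pos.2 hπ.2).ne'
  field_simp
  ring

variable [IsProbabilityMeasure μ]

theorem tendsto_deltaZ (hN : M.IsNice Θ O C) (hπ : 0 < π ∧ π < 1)
    (hS : IsPerturbedSample μ (Θ.prod (treatmentLaw π)) h x U) (hp₀ : p₀ ∈ O)
    (hP : ∀ᶠ y : ℕ × Ω in inProbability μ, ‖P y - p₀‖ ≤ K * h y.1) :
    Tendsto (fun y => Estimator.deltaZ (samplePerturbation U y) (M.sampleObservedExcess x U P y))
      (inProbability μ) (𝓝 (M.excessGradient Θ π p₀)) := by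
  have : IsProbabilityMeasure (treatmentLaw π) := isProbabilityMeasure_treatmentLaw hπ
  refine tendsto_gram_inv_mul (s := fun y => ((y.1 : ℝ) * h y.1 ^ 2)⁻¹) ?_ hS.tendsto_gram ?_
  · filter_upwards [hS.eventually_pos, tendsto_fst_inProbability.eventually_gt_atTop 0] with y h1 h2
    have : (0 : ℝ) < y.1 := by exact_mod_cast h2
    positivity
  · refine tendsto_pi_nhds.2 fun j => tendsto_pi_nhds.2 fun k => ?_
    have h1 := hS.tendsto_avg_perturbation_mul (hN.excess k) hN.convex hN.isOpen hN.nonneg hp₀ hP j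
    rw [← hN.excessGradient_apply hπ hp₀] at h1
    refine h1.congr fun y => ?_
    simp only [avg, Matrix.smul_apply, Matrix.mul_apply, Matrix.transpose_apply,
      samplePerturbation, sampleObservedExcess, observedExcess, Matrix.of_apply, smul_eq_mul,
      mul_inv]
    ring

theorem tendsto_deltaY (hN : M.IsNice Θ O C) (hπ : 0 < π ∧ π < 1)
    (hS : IsPerturbedSample μ (Θ.prod (treatmentLaw π)) h x U) (hp₀ : p₀ ∈ O)
    (hP : ∀ᶠ y : ℕ × Ω in inProbability μ, ‖P y - p₀‖ ≤ K * h y.1) :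
    Tendsto (fun y => Estimator.deltaY (samplePerturbation U y) (M.sampleObservedOutcome x U P y))
      (inProbability μ) (𝓝 (M.outcomeGradient Θ π p₀)) := by
  have : IsProbabilityMeasure (treatmentLaw π) := isProbabilityMeasure_treatmentLaw hπ
  refine tendsto_gram_inv_mulVec (s := fun y => ((y.1 : ℝ) * h y.1 ^ 2)⁻¹) ?_ hS.tendsto_gram ?_
  · filter_upwards [hS.eventually_pos, tendsto_fst_inProbability.eventually_gt_atTop 0] with y h1 h2
    have : (0 : ℝ) < y.1 := by exact_mod_cast h2
    positivity
  · refine tendsto_pi_nhds.2 fun j => ?_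
    have h1 := hS.tendsto_avg_perturbation_mul hN.outcome hN.convex hN.isOpen hN.nonneg hp₀ hP j
    rw [← hN.outcomeGradient_apply hπ hp₀] at h1
    refine h1.congr fun y => ?_
    simp only [avg, Pi.smul_apply, Matrix.mulVec, dotProduct, Matrix.transpose_apply,
      samplePerturbation, sampleObservedOutcome, observedOutcome, Matrix.of_apply, smul_eq_mul,
      mul_inv]
    ring

theorem tendsto_tauZ (hN : M.IsNice Θ O C) (hπ : 0 < π ∧ π < 1)
    (hS : IsPerturbedSample μ (Θ.prod (treatmentLaw π)) h x U) (hp₀ : p₀ ∈ O)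
    (hP : ∀ᶠ y : ℕ × Ω in inProbability μ, ‖P y - p₀‖ ≤ K * h y.1) :
    Tendsto (fun y => Estimator.tauZ π (sampleTreatment x y) (M.sampleObservedExcess x U P y))
      (inProbability μ) (𝓝 (M.excessEffect Θ p₀)) := by
  have : IsProbabilityMeasure (treatmentLaw π) := isProbabilityMeasure_treatmentLaw hπ
  refine tendsto_pi_nhds.2 fun k => ?_
  have h1 : 0 < π⁻¹ := inv_pos.2 hπ.1
  have h2 : 0 < (1 - π)⁻¹ := inv_pos.2 (sub_pos.2 hπ.2)
  have h3 := hS.tendsto_avg_mul_perturbed (hN.excess k) hN.convex hN.isOpen hN.nonneg hp₀ hP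
    (φ := fun z => horvitzThompsonWeight π z.2)
    ((measurable_of_finite (horvitzThompsonWeight π)).comp measurable_snd)
    (fun z => abs_horvitzThompsonWeight_le hπ z.2) (by positivity)
  rw [hN.integral_weight_mul_excess hπ hp₀] at h3
  refine h3.congr fun y => ?_
  rw [tauZ_eq_avg]
  rfl

theorem tendsto_gammaHat (hN : M.IsNice Θ O C) (hπ : 0 < π ∧ π < 1)
    (hS : IsPerturbedSample μ (Θ.prod (treatmentLaw π)) h x U) (hp₀ : p₀ ∈ O)
    (hP : ∀ᶠ y : ℕ × Ω in inProbability μ, ‖P y - p₀‖ ≤ K * h y.1)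
    (hJ : IsUnit (M.excessGradient Θ π p₀)) :
    Tendsto (fun y => Estimator.gammaHat (samplePerturbation U y) (M.sampleObservedExcess x U P y)
        (M.sampleObservedOutcome x U P y))
      (inProbability μ) (𝓝 ((M.excessGradient Θ π p₀)⁻¹ *ᵥ M.outcomeGradient Θ π p₀)) :=
  tendsto_mulVec (tendsto_matrix_inv (hN.tendsto_deltaZ hπ hS hp₀ hP) hJ)
    (hN.tendsto_deltaY hπ hS hp₀ hP)

/-- At the mean-field price the limit is minus the derivative found in `hasDerivAt_meanFieldPrice`.
-/
theorem tendsto_bHat (hN : M.IsNice Θ O C) (hπ : 0 < π ∧ π < 1)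
    (hS : IsPerturbedSample μ (Θ.prod (treatmentLaw π)) h x U) (hp₀ : p₀ ∈ O)
    (hP : ∀ᶠ y : ℕ × Ω in inProbability μ, ‖P y - p₀‖ ≤ K * h y.1)
    (hJ : IsUnit (M.excessGradient Θ π p₀)) :
    Tendsto (fun y => Estimator.bHat π (sampleTreatment x y) (samplePerturbation U y)
        (M.sampleObservedExcess x U P y))
      (inProbability μ) (𝓝 (((M.excessGradient Θ π p₀)ᵀ)⁻¹ *ᵥ ⇑(M.excessEffect Θ p₀))) := by
  have hc : Continuous fun A : Matrix (Fin J) (Fin J) ℝ => Aᵀ := continuous_id.matrix_transpose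
  refine tendsto_mulVec (tendsto_matrix_inv
    ((hc.tendsto _).comp (hN.tendsto_deltaZ hπ hS hp₀ hP)) ?_) (hN.tendsto_tauZ hπ hS hp₀ hP)
  rw [Matrix.isUnit_iff_isUnit_det, Matrix.det_transpose]
  exact (Matrix.isUnit_iff_isUnit_det _).1 hJ

/-- The average squared residual is consistent when the coefficients are. -/
theorem tendsto_avg_residual_sq (hN : M.IsNice Θ O C) (hπ : 0 < π ∧ π < 1)
    (hS : IsPerturbedSample μ (Θ.prod (treatmentLaw π)) h x U) (hp₀ : p₀ ∈ O)
    (hP : ∀ᶠ y : ℕ × Ω in inProbability μ, ‖P y - p₀‖ ≤ K * h y.1)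
    {γh : ℕ × Ω → Fin J → ℝ} {γ : Fin J → ℝ} (hγ : Tendsto γh (inProbability μ) (𝓝 γ)) :
    Tendsto (fun y : ℕ × Ω => avg fun i =>
        (M.outcome (x y.1 i y.2).1 (x y.1 i y.2).2 (P y + WithLp.toLp 2 (U y.1 i y.2)) -
          (fun j => M.excess (x y.1 i y.2).1 (x y.1 i y.2).2
            (P y + WithLp.toLp 2 (U y.1 i y.2)) j) ⬝ᵥ γh y) ^ 2)
      (inProbability μ) (𝓝 (∫ z, (M.outcome z.1 z.2 p₀ -
        (fun j => M.excess z.1 z.2 p₀ j) ⬝ᵥ γ) ^ 2 ∂(Θ.prod (treatmentLaw π)))) := by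
  have : IsProbabilityMeasure (treatmentLaw π) := isProbabilityMeasure_treatmentLaw hπ
  have hC := hN.nonneg
  set r₀ : Ξ × Bool → ℝ := fun z => M.outcome z.1 z.2 p₀ - (fun j => M.excess z.1 z.2 p₀ j) ⬝ᵥ γ
    with hr₀
  set R := C + ∑ j, C * |γ j| with hR
  have hR0 : 0 ≤ R := by positivity
  have hrm : Measurable r₀ :=
    (hN.outcome.measurable p₀).sub (Finset.measurable_sum _ fun j _ =>
      ((hN.excess j).measurable p₀).mul_const _)
  have hrR : ∀ z, |r₀ z| ≤ R := fun z => by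
    refine (abs_sub _ _).trans (add_le_add (hN.outcome.bound z p₀ hp₀) ?_)
    refine (Finset.abs_sum_le_sum_abs _ _).trans (Finset.sum_le_sum fun j _ => ?_)
    rw [abs_mul]
    gcongr
    exact (hN.excess j).bound z p₀ hp₀
  have hlim := hS.tendsto_avg_fst (hrm.pow_const 2) (C := R ^ 2) fun z => by
    rw [abs_pow]
    exact pow_le_pow_left₀ (abs_nonneg _) (hrR z) 2
  -- A bound on the change of every residual at once: the outcome moves, excess demand moves against
  -- `γh`, and `γh - γ` is multiplied by excess demand at `p₀`.
  set d : ℕ × Ω → ℝ := fun y => C * (K + J) * h y.1 +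
    ∑ j, (C * (K + J) * h y.1 * |γh y j| + C * |γh y j - γ j|) with hd
  have hd0 : Tendsto d (inProbability μ) (𝓝 0) := by
    have h1 := hS.tendsto_size.const_mul (C * (K + J))
    have h2 := fun j => (tendsto_pi_nhds.1 hγ j)
    have h3 := tendsto_finsetSum (Finset.univ : Finset (Fin J)) fun j _ =>
      (h1.mul (h2 j).abs).add (((h2 j).sub_const (γ j)).abs.const_mul C)
    simpa using h1.add h3
  have hrem : Tendsto (fun y => d y * (d y + 2 * R)) (inProbability μ) (𝓝 0) := by
    simpa using hd0.mul (hd0.add_const (2 * R))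
  refine hlim.congr_dist (squeeze_zero' (Eventually.of_forall fun _ => dist_nonneg) ?_ hrem)
  have hev := fun k => hS.eventually_abs_sub_le (hN.excess k) hN.convex hN.isOpen hC hp₀ hP
  filter_upwards [hS.eventually_abs_sub_le hN.outcome hN.convex hN.isOpen hC hp₀ hP,
    eventually_all.2 hev, tendsto_fst_inProbability.eventually_gt_atTop 0] with y h1 h2 h0
  rw [Real.dist_eq, abs_sub_comm]
  have hs0 : 0 ≤ C * (K + J) * h y.1 := (abs_nonneg _).trans (h1 ⟨0, h0⟩)
  refine abs_avg_sq_sub_avg_sq_le (by positivity) hR0 (fun i => ?_) fun i => hrR _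
  set Y := M.outcome (x y.1 i y.2).1 (x y.1 i y.2).2 (P y + WithLp.toLp 2 (U y.1 i y.2)) with hY
  set Z := fun j => M.excess (x y.1 i y.2).1 (x y.1 i y.2).2 (P y + WithLp.toLp 2 (U y.1 i y.2)) j
    with hZ
  set Z₀ := fun j => M.excess (x y.1 i y.2).1 (x y.1 i y.2).2 p₀ j with hZ₀
  change |(Y - Z ⬝ᵥ γh y) - (M.outcome (x y.1 i y.2).1 (x y.1 i y.2).2 p₀ - Z₀ ⬝ᵥ γ)| ≤ _
  have h3 : (Y - Z ⬝ᵥ γh y) - (M.outcome (x y.1 i y.2).1 (x y.1 i y.2).2 p₀ - Z₀ ⬝ᵥ γ) =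
      (Y - M.outcome (x y.1 i y.2).1 (x y.1 i y.2).2 p₀) -
        ∑ j, ((Z j - Z₀ j) * γh y j + Z₀ j * (γh y j - γ j)) := by
    have h4 : ∑ j, ((Z j - Z₀ j) * γh y j + Z₀ j * (γh y j - γ j)) = Z ⬝ᵥ γh y - Z₀ ⬝ᵥ γ := by
      rw [dotProduct, dotProduct, ← Finset.sum_sub_distrib]
      exact Finset.sum_congr rfl fun j _ => by ring
    rw [h4]
    ring
  rw [h3]
  refine (abs_sub _ _).trans (add_le_add (h1 i) ?_)
  refine (Finset.abs_sum_le_sum_abs _ _).trans (Finset.sum_le_sum fun j _ => ?_)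
  refine (abs_add_le _ _).trans ?_
  rw [abs_mul, abs_mul]
  gcongr
  · exact h2 j i
  · exact (hN.excess j).bound _ p₀ hp₀

theorem tendsto_vHatSq (hN : M.IsNice Θ O C) (hπ : 0 < π ∧ π < 1)
    (hS : IsPerturbedSample μ (Θ.prod (treatmentLaw π)) h x U) (hp₀ : p₀ ∈ O)
    (hP : ∀ᶠ y : ℕ × Ω in inProbability μ, ‖P y - p₀‖ ≤ K * h y.1)
    (hJ : IsUnit (M.excessGradient Θ π p₀)) :
    Tendsto (fun y => Estimator.vHatSq (samplePerturbation U y) (M.sampleObservedExcess x U P y)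
        (M.sampleObservedOutcome x U P y))
      (inProbability μ) (𝓝 (∫ z, (M.outcome z.1 z.2 p₀ - (fun j => M.excess z.1 z.2 p₀ j) ⬝ᵥ
        ((M.excessGradient Θ π p₀)⁻¹ *ᵥ M.outcomeGradient Θ π p₀)) ^ 2
          ∂(Θ.prod (treatmentLaw π)))) :=
  hN.tendsto_avg_residual_sq hπ hS hp₀ hP (hN.tendsto_gammaHat hπ hS hp₀ hP hJ)

end IsNice

end Market

/-- The experimental design of independent individuals, treatments and perturbations of size
`c * n ^ (-α)`, as a perturbed sample. -/
theorem isPerturbedSample_of_design {J : ℕ} {Ξ : Type*} [MeasurableSpace Ξ] {Θ : Measure Ξ}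
    [IsProbabilityMeasure Θ] {π : ℝ} (hπ : 0 < π ∧ π < 1) {c α : ℝ} (hc : 0 < c) (hα0 : 0 < α)
    (hα : α < 1 / 2) {h : ℕ → ℝ} (hh : ∀ n, h n = c * (n : ℝ) ^ (-α))
    {Ω : Type*} [MeasurableSpace Ω] {μ : Measure Ω}
    {ξ : (n : ℕ) → Fin n → Ω → Ξ} {W : (n : ℕ) → Fin n → Ω → Bool}
    {U : (n : ℕ) → Fin n → Ω → Fin J → ℝ}
    (hindep : ∀ n, iIndepFun (fun i ω => (ξ n i ω, W n i ω, U n i ω)) μ)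
    (hlaw : ∀ n i, HasLaw (fun ω => (ξ n i ω, W n i ω, U n i ω))
      (Θ.prod ((treatmentLaw π).prod (perturbationLaw J (h n)))) μ) :
    IsPerturbedSample μ (Θ.prod (treatmentLaw π)) h (fun n i ω => (ξ n i ω, W n i ω)) U where
  indep n := (hindep n).comp (fun _ z => ((z.1, z.2.1), z.2.2)) (fun _ => by fun_prop)
  law n i := by
    have : IsProbabilityMeasure (treatmentLaw π) := isProbabilityMeasure_treatmentLaw hπ
    refine HasLaw.fun_comp (Y := MeasurableEquiv.prodAssoc.symm) ⟨by fun_prop, ?_⟩ (hlaw n i)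
    rw [← Measure.prodAssoc_prod, MeasurableEquiv.map_symm_map]
  pos := by
    filter_upwards [eventually_gt_atTop 0] with n hn
    have : (0 : ℝ) < n := by exact_mod_cast hn
    rw [hh]
    positivity
  tendsto_zero := by
    have h1 := ((tendsto_rpow_neg_atTop hα0).comp tendsto_natCast_atTop_atTop).const_mul c
    rw [mul_zero] at h1
    exact h1.congr fun n => (hh n).symm
  slow := by
    -- Here `(n h²)⁻¹ = c⁻² n ^ (-(1 - 2α))`, which vanishes precisely because `α < 1/2`.
    have h1 := ((tendsto_rpow_neg_atTop (show 0 < 1 - 2 * α by linarith)).comp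
      tendsto_natCast_atTop_atTop).const_mul (c ^ 2)⁻¹
    rw [mul_zero] at h1
    refine h1.congr' ?_
    filter_upwards [eventually_gt_atTop 0] with n hn
    have hn' : (0 : ℝ) < n := by exact_mod_cast hn
    simp only [Function.comp_apply]
    rw [hh, mul_pow, ← Real.rpow_natCast ((n : ℝ) ^ (-α)), ← Real.rpow_mul hn'.le,
      Real.rpow_neg hn'.le, ← mul_inv]
    congr 1
    rw [show 1 - 2 * α = 1 + -α * (2 : ℕ) by push_cast; ring, Real.rpow_add hn', Real.rpow_one]
    ring

theorem proposition2
    -- the population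
    {J : ℕ} {Ξ : Type*} [MeasurableSpace Ξ] (Θ : Measure Ξ) [IsProbabilityMeasure Θ]
    (M : Market Ξ J) (l u : Price J) (π : ℝ) (hπ : 0 < π ∧ π < 1)
    (hmeas : M.IsMeasurable) (hbounds : M.HasPriceBounds Θ l u)
    (hsmooth : M.IsSmoothBounded l u) (hreg : M.IsRegular Θ l u π)
    -- size of the perturbations
    (c α : ℝ) (hc : 0 < c) (hα : 1 / 4 < α ∧ α < 1 / 2)
    (h : ℕ → ℝ) (hh : ∀ n, h n = c * (n : ℝ) ^ (-α))
    -- sampling of the types and design of the experiment, for each market size `n`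
    {Ω : Type*} [MeasurableSpace Ω] (μ : Measure Ω) [IsProbabilityMeasure μ]
    (ξ : (n : ℕ) → Fin n → Ω → Ξ) (W : (n : ℕ) → Fin n → Ω → Bool)
    (U : (n : ℕ) → Fin n → Ω → Fin J → ℝ)
    (hindep : ∀ n, iIndepFun (fun i ω => (ξ n i ω, W n i ω, U n i ω)) μ)
    (hlaw : ∀ n i, HasLaw (fun ω => (ξ n i ω, W n i ω, U n i ω))
      (Θ.prod ((treatmentLaw π).prod (perturbationLaw J (h n)))) μ)
    -- approximate market clearing, under all perturbations of size at most `B`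
    (happrox : ∃ B > 0, ∃ a : ℕ → ℝ, Tendsto (fun n : ℕ => (n : ℝ) * a n) atTop (𝓝 0) ∧
      ∀ᵐ ω ∂μ, ∀ᶠ n in atTop, ∀ V : Fin n → Fin J → ℝ, (∀ i j, |V i j| ≤ B) →
        ∃ p, ‖M.averageExcess (fun i => ξ n i ω) (fun i => W n i ω) V p‖ ≤ a n)
    -- the market price in the perturbed market, with any rule for breaking ties
    (P : ℕ → Ω → Price J)
    (hP : ∀ n, ∀ᵐ ω ∂μ,
      M.IsMarketPrice (fun i => ξ n i ω) (fun i => W n i ω) (fun i => U n i ω) (P n ω)) :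
    -- the limit `σ_I²` is well defined
    (∃! p, M.IsMeanFieldPrice Θ l u π p) ∧
    DifferentiableAt ℝ (M.meanFieldPrice Θ l u) π ∧
    -- and the plug-in estimator converges to it in probability
    TendstoInMeasure μ
      (fun n ω =>
        Estimator.sigmaISqHat π (fun i => W n i ω)
          (Matrix.of fun i => U n i ω)
          (M.observedExcess (fun i => ξ n i ω) (fun i => W n i ω) (fun i => U n i ω) (P n ω))
          (M.observedOutcome (fun i => ξ n i ω) (fun i => W n i ω) (fun i => U n i ω) (P n ω)))
      atTop (fun _ => M.sigmaISq Θ l u π) := by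
  have : IsProbabilityMeasure (treatmentLaw π) := isProbabilityMeasure_treatmentLaw hπ
  obtain ⟨δ, hδ, C, hN⟩ := hsmooth.exists_isNice (Θ := Θ) hmeas
  have hO : priceBox l u ⊆ Metric.thickening δ (priceBox l u) :=
    Metric.self_subset_thickening hδ _
  have hne : (priceBox l u).Nonempty := ⟨l, fun j => ⟨le_rfl, (hbounds.lower_lt_upper j).le⟩⟩
  obtain ⟨κ, hκ, -, -, hlip⟩ := hN.exists_contraction hπ hO hne hreg.contraction
  have hex := hN.existsUnique_isMeanFieldPrice hbounds hπ hO hκ hlip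
  have hp₀ : M.IsMeanFieldPrice Θ l u π (M.meanFieldPrice Θ l u π) :=
    Classical.epsilon_spec hex.exists
  have hderiv := hN.hasDerivAt_meanFieldPrice hbounds hπ hO hκ hlip hreg.jacobian
  refine ⟨hex, hderiv.differentiableAt, tendstoInMeasure_iff_inProbability.2 ?_⟩
  have hS := isPerturbedSample_of_design hπ hc (by linarith [hα.1]) hα.2 hh hindep hlaw
  obtain ⟨K, hK⟩ := hN.eventually_norm_marketPrice_sub_le hδ hbounds hπ hS hp₀ hreg.contraction
    (P := fun y => P y.1 y.2) (eventually_inProbability_of_ae (Eventually.of_forall hP))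
  have hb := hN.tendsto_bHat hπ hS (hO hp₀.1) hK hreg.jacobian
  have hv := hN.tendsto_vHatSq hπ hS (hO hp₀.1) hK hreg.jacobian
  have hc : Continuous fun v : Fin J → ℝ => v ⬝ᵥ v := continuous_id.dotProduct continuous_id
  have hlim := ((hc.tendsto _).comp hb).mul hv
  refine (Tendsto.congr (fun _ => rfl) hlim).trans_eq ?_
  -- The minus sign of the derivative cancels in the inner product, so the limit of `b̂ᵀ b̂` is the
  -- squared norm of the price derivative.
  rw [Market.sigmaISq, hderiv.deriv, inner_neg_neg, mul_comm, EuclideanSpace.inner_eq_star_dotProduct]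
  rfl
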